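/- **Categories.** A morphism is a *cover* if it factors through no proper subobject of its codomain. A *Heyting category* is a category with finite limits and images, in which pullbacks of covers are covers, each poset $\mathrm{Sub}(X)$ of subobjects has finite suprema (including a least element), and for each $f:X\to Y$ the inverse image map $f^*:\mathrm{Sub}(Y)\to\mathrm{Sub}(X)$ preserves finite suprema and has adjoints $\exists_f\dashv f^*\dashv\forall_f$. It is *Boolean* if moreover every $\mathrm{Sub}(X)$ is a Boolean algebra. A *Heyting functor* is a functor between Heyting categories that preserves finite limits, images, finite suprema of subobjects, $\exists_f$ and $\forall_f$; a *Boolean functor* is a Heyting functor between Boolean categories. An *IMLU-category* is a pair $(\mathbf M,\mathbf N)$ of Heyting categories, where $\mathbf N$ is a subcategory of $\mathbf M$ whose inclusion is a Heyting functor that reflects isomorphisms (more generally: $\mathbf N$ comes with a faithful Heyting functor to $\mathbf M$ that reflects isomorphisms, used like an inclusion), together with * an object $U$ of $\mathbf N$ such that every object of $\mathbf N$ has a mono to $U$ in $\mathbf N$; * an endofunctor $\mathbf T$ of $\mathbf M$ that restricts (up to natural isomorphism, in the more general setting) to an endofunctor of $\mathbf N$, and a natural isomorphism $\iota:\mathrm{id}_{\mathbf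 M}\cong\mathbf T$; * an endofunctor $\mathbf P$ of $\mathbf N$ and, for each object $A$ of $\mathbf N$, a morphism $\subseteq^{\mathbf T}_A\;\to\mathbf TA\times\mathbf PA$ of $\mathbf N$ that is monic in $\mathbf M$, such that for every morphism $r:R\to\mathbf TA\times B$ of $\mathbf N$ that is monic in $\mathbf M$ there is $\chi:B\to\mathbf PA$ in $\mathbf N$ that is the unique morphism of $\mathbf M$ for which $r$ is, in $\mathbf M$, a pullback of $\subseteq^{\mathbf T}_A$ along $\mathrm{id}\times\chi$; and $\mathbf P$ acts on morphisms by direct images, i.e. for $f:A\to B$ in $\mathbf N$, $(\mathrm{id}\times\mathbf Pf)^*(\subseteq^{\mathbf T}_B)=\exists_{\mathbf Tf\times\mathrm{id}}(\subseteq^{\mathbf T}_A)$ as subobjects of $\mathbf TB\times\mathbf PA$ in $\mathbf N$; * a natural isomorphism $\mu:\mathbf P\circ\mathbf T\cong\mathbf T\circ\mathbf P$ on $\mathbf N$. It is an *MLU-category* if $\mathbf M$ and $\mathbf N$ are Boolean; it is an *(I)ML-category* if moreover $U\cong\mathbf PU$ in $\mathbf N$. **Set theories.** Let $\mathcal L$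 be the first-order language with equality, a binary relation $\in$, a unary relation $S$ and a binary function symbol $\langle-,-\rangle$. A formula is *stratified* if natural numbers (types) can be assigned to its terms, bound variables being renamed apart, such that $\langle v,w\rangle$, $v$ and $w$ always have the same type, atomic subformulas $u=v$ have sides of the same type, and in atomic subformulas $u\in v$ the type of $v$ is one more than that of $u$. The axioms of $\mathrm{(I)NFU}$ are the universal closures of $(S(x)\wedge S(y)\wedge\forall z(z\in x\leftrightarrow z\in y))\to x=y$; of $\langle x,y\rangle=\langle x',y'\rangle\to(x=x'\wedge y=y')$; of $z\in x\to S(x)$; and of $\exists x(S(x)\wedge\forall z(z\in x\leftrightarrow\phi))$ for all stratified $\phi$ in which $x$ is not free (parameters allowed). $\mathrm{(I)NF}$ has the additional axiom $\forall x\,S(x)$. $\mathrm{INFU}$, $\mathrm{INF}$ are taken in intuitionistic, $\mathrm{NFU}$, $\mathrm{NF}$ in classical logic. **Theorem.** Let $(\mathbf M,\mathbf N)$ be an IMLU-category. There are monos $m_S:\mathbf PU\rightarrowtail U$ and $m_P:U\times U\rightarrowtail U$ in $\mathbf N$. For any such monos, let $\mathcal U$ be the $\mathcal L$-structure in the categorical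 semantics of $\mathbf M$ with carrier $U$ that interprets $S$ by the subobject $m_S$ of $U$, $\langle-,-\rangle$ by $m_P$, and $\in$ by the subobject $(\mathrm{id}_U\times m_S)\circ m_{\in_U}$ of $U\times U$, where $m_{\in_U}$ is the pullback in $\mathbf M$ of $\subseteq^{\mathbf T}_U\;\rightarrowtail\mathbf TU\times\mathbf PU$ along $\iota_U\times\mathrm{id}:U\times\mathbf PU\to\mathbf TU\times\mathbf PU$. Then: 1. $\mathcal U$ satisfies all axioms of $\mathrm{(I)NFU}$. 2. If $m_S$ is an isomorphism, $\mathcal U$ satisfies all axioms of $\mathrm{(I)NF}$; and if $U\cong\mathbf PU$ in $\mathbf N$, then $m_S$ can be chosen to be an isomorphism. 3. Hence $\mathrm{(I)NF(U)}$ is interpreted, by the translation $\phi\mapsto(\mathcal U\models\phi)$, in the theory of $\mathrm{(I)ML(U)}$-categories: every sentence provable in $\mathrm{INFU}$ is valid in $\mathcal U$, and so is every sentence provable in $\mathrm{NFU}$ if $(\mathbf M,\mathbf N)$ is an MLU-category; if $m_S$ is an isomorphism, the same holds with $\mathrm{INF}$ and $\mathrm{NF}$ in place of $\mathrm{INFU}$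 and $\mathrm{NFU}$. -/

import Mathlib

open CategoryTheory CategoryTheory.Limits

universe v₁ u₁ v₂ u₂

noncomputable section

/-! ## Heyting and Boolean categories -/

/-- A cover: a morphism that factors through no proper subobject of its codomain. -/
def IsCover {C : Type u₁} [Category.{v₁} C] {X Y : C} (f : X ⟶ Y) : Prop :=
  ∀ ⦃Z : C⦄ (g : X ⟶ Z) (m : Z ⟶ Y), Mono m → g ≫ m = f → IsIso m

/-- Heyting categories.  Sup-semilattices have a least element (the empty supremum). -/
class HeytingCategory (C : Type u₁) [Category.{v₁} C] : Prop
    extends HasFiniteLimits C, HasImages C where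
  cover_of_isPullback : ∀ {P X Y Z : C} {fst : P ⟶ X} {snd : P ⟶ Y} {f : X ⟶ Z} {g : Y ⟶ Z},
    IsPullback fst snd f g → IsCover f → IsCover snd
  exists_isBot : ∀ X : C, ∃ b : Subobject X, IsBot b
  exists_isLUB : ∀ (X : C) (a b : Subobject X), ∃ c, IsLUB {a, b} c
  pullback_isBot : ∀ {X Y : C} (f : X ⟶ Y) (b : Subobject Y),
    IsBot b → IsBot ((Subobject.pullback f).obj b)
  pullback_isLUB : ∀ {X Y : C} (f : X ⟶ Y) (a b c : Subobject Y), IsLUB {a, b} c →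
    IsLUB {(Subobject.pullback f).obj a, (Subobject.pullback f).obj b}
      ((Subobject.pullback f).obj c)
  exists_leftAdjoint : ∀ {X Y : C} (f : X ⟶ Y), ∃ E : Subobject X → Subobject Y,
    GaloisConnection E (Subobject.pullback f).obj
  exists_rightAdjoint : ∀ {X Y : C} (f : X ⟶ Y), ∃ A : Subobject X → Subobject Y,
    GaloisConnection (Subobject.pullback f).obj A

namespace HeytingCategory

variable {C : Type u₁} [Category.{v₁} C] [HeytingCategory C]

/-- The least subobject. -/
def botSub (X : C) : Subobject X := (exists_isBot X).choose

/-- The union of two subobjects. -/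
def supSub {X : C} (a b : Subobject X) : Subobject X := (exists_isLUB X a b).choose

/-- The left adjoint of the inverse image functor. -/
def existsSub {X Y : C} (f : X ⟶ Y) : Subobject X → Subobject Y := (exists_leftAdjoint f).choose

/-- The right adjoint of the inverse image functor. -/
def forallSub {X Y : C} (f : X ⟶ Y) : Subobject X → Subobject Y := (exists_rightAdjoint f).choose

/-- Heyting implication of subobjects, characterised by `le_himpSub_iff`. -/
def himpSub {X : C} (a b : Subobject X) : Subobject X :=
  forallSub a.arrow ((Subobject.pullback a.arrow).obj b)

theorem botSub_isBot (X : C) : IsBot (botSub X) := (exists_isBot X).choose_spec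

theorem supSub_isLUB {X : C} (a b : Subobject X) : IsLUB {a, b} (supSub a b) :=
  (exists_isLUB X a b).choose_spec

theorem existsSub_gc {X Y : C} (f : X ⟶ Y) :
    GaloisConnection (existsSub f) (Subobject.pullback f).obj :=
  (exists_leftAdjoint f).choose_spec

theorem forallSub_gc {X Y : C} (f : X ⟶ Y) :
    GaloisConnection (Subobject.pullback f).obj (forallSub f) :=
  (exists_rightAdjoint f).choose_spec

theorem le_himpSub_iff {X : C} (a b c : Subobject X) : c ≤ himpSub a b ↔ c ⊓ a ≤ b := by
  have h : ∀ d : Subobject X,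
      (Subobject.map a.arrow).obj ((Subobject.pullback a.arrow).obj d) = a ⊓ d := by
    intro d
    rw [Subobject.inf_eq_map_pullback]
  have gc := (Subobject.mapPullbackAdj a.arrow).gc
  rw [himpSub, ← forallSub_gc a.arrow _ _, ← gc, h, inf_comm]

end HeytingCategory

open HeytingCategory

/-- Boolean categories: Heyting categories in which every subobject has a complement. -/
class BooleanCategory (C : Type u₁) [Category.{v₁} C] : Prop extends HeytingCategory C where
  exists_compl : ∀ {X : C} (a : Subobject X), ∃ b : Subobject X,
    IsBot (a ⊓ b) ∧ IsLUB {a, b} (⊤ : Subobject X)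

/-- The subobject `F(a)` of `F(X)`, for a finite limit preserving functor `F`. -/
def mapSub {C : Type u₁} [Category.{v₁} C] {D : Type u₂} [Category.{v₂} D]
    (F : C ⥤ D) [PreservesFiniteLimits F] {X : C} (a : Subobject X) : Subobject (F.obj X) :=
  Subobject.mk (F.map a.arrow)

/-- Heyting functors; between Boolean categories these are exactly the Boolean functors, since
complements are preserved together with meets, joins, top and bottom. -/
class IsHeytingFunctor {C : Type u₁} [Category.{v₁} C] [HeytingCategory C]
    {D : Type u₂} [Category.{v₂} D] [HeytingCategory D] (F : C ⥤ D) : Prop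
    extends PreservesFiniteLimits F where
  map_image : ∀ {X Y : C} (f : X ⟶ Y), mapSub F (imageSubobject f) = imageSubobject (F.map f)
  map_bot : ∀ X : C, mapSub F (botSub X) = botSub (F.obj X)
  map_sup : ∀ {X : C} (a b : Subobject X),
    mapSub F (supSub a b) = supSub (mapSub F a) (mapSub F b)
  map_exists : ∀ {X Y : C} (f : X ⟶ Y) (a : Subobject X),
    mapSub F (existsSub f a) = existsSub (F.map f) (mapSub F a)
  map_forall : ∀ {X Y : C} (f : X ⟶ Y) (a : Subobject X),
    mapSub F (forallSub f a) = forallSub (F.map f) (mapSub F a)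

/-! ## Stratified categories of classes -/

section Relations

variable {M : Type u₁} [Category.{v₁} M] [HeytingCategory M]
  {N : Type u₂} [Category.{v₂} N] [HeytingCategory N]

/-- A morphism `r : R ⟶ A × B` of `N`, viewed as a morphism into the product in `M`. -/
def relMap (F : N ⥤ M) {A B R : N} (r : R ⟶ A ⨯ B) : F.obj R ⟶ F.obj A ⨯ F.obj B :=
  F.map r ≫ prodComparison F A B

theorem mono_relMap (F : N ⥤ M) [PreservesFiniteLimits F] {A B R : N} (r : R ⟶ A ⨯ B)
    [Mono (F.map r)] : Mono (relMap F r) := by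
  unfold relMap
  infer_instance

end Relations

/-- A stratified category of classes, i.e. an IMLU-category `(M, N)`.  The subcategory `N` of `M`
is given by its faithful inclusion functor `incl`, and the restriction of the endofunctor `T` to
`N` is `TN`. -/
structure IMLUCategory (M : Type u₁) [Category.{v₁} M] [HeytingCategory M]
    (N : Type u₂) [Category.{v₂} N] [HeytingCategory N] where
  incl : N ⥤ M
  faithful : incl.Faithful
  conservative : incl.ReflectsIsomorphisms
  heyting : IsHeytingFunctor incl
  /-- The universal object of `N`. -/
  U : N
  universal : ∀ A : N, ∃ f : A ⟶ U, Mono f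
  T : M ⥤ M
  TN : N ⥤ N
  restrict : TN ⋙ incl ≅ incl ⋙ T
  ι : 𝟭 M ≅ T
  P : N ⥤ N
  /-- The object `⊆ᵀ_A`. -/
  sub : N → N
  /-- The relation `⊆ᵀ_A ⟶ T A × P A`. -/
  subMap : ∀ A : N, sub A ⟶ TN.obj A ⨯ P.obj A
  subMap_mono : ∀ A : N, Mono (incl.map (subMap A))
  /-- `P A` with `⊆ᵀ_A` is a power object of `T A` in `M` with respect to `N`. -/
  power : ∀ {A B R : N} (r : R ⟶ TN.obj A ⨯ B), Mono (incl.map r) →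
    ∃ χ : B ⟶ P.obj A,
      (∃ top, IsPullback top (relMap incl r) (relMap incl (subMap A))
        (prod.map (𝟙 (incl.obj (TN.obj A))) (incl.map χ))) ∧
      ∀ χ' : incl.obj B ⟶ incl.obj (P.obj A),
        (∃ top, IsPullback top (relMap incl r) (relMap incl (subMap A))
          (prod.map (𝟙 (incl.obj (TN.obj A))) χ')) → χ' = incl.map χ
  /-- `P` acts on morphisms by direct images: `y` is in `(P f)(x)` iff `y = f(z)` for some `z`
  in `x`, as subobjects of `T B × P A` in `N`. -/
  map_power : ∀ {A B : N} (f : A ⟶ B),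
    (Subobject.pullback (prod.map (𝟙 (TN.obj B)) (P.map f))).obj (imageSubobject (subMap B)) =
      existsSub (prod.map (TN.map f) (𝟙 (P.obj A))) (imageSubobject (subMap A))
  μ : TN ⋙ P ≅ P ⋙ TN

/-! ## The language of set theory -/

/-- Terms in the variables `0, …, n - 1`, with the pairing function symbol. -/
inductive SetTerm (n : ℕ) : Type
  | var : Fin n → SetTerm n
  | pair : SetTerm n → SetTerm n → SetTerm n

/-- Formulas in the free variables `0, …, n - 1`.  A quantifier binds the variable `0` and shifts
the other ones by one. -/
inductive SetFormula : ℕ → Type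
  | bot {n : ℕ} : SetFormula n
  | eq {n : ℕ} : SetTerm n → SetTerm n → SetFormula n
  | mem {n : ℕ} : SetTerm n → SetTerm n → SetFormula n
  | isSet {n : ℕ} : SetTerm n → SetFormula n
  | and {n : ℕ} : SetFormula n → SetFormula n → SetFormula n
  | or {n : ℕ} : SetFormula n → SetFormula n → SetFormula n
  | imp {n : ℕ} : SetFormula n → SetFormula n → SetFormula n
  | all {n : ℕ} : SetFormula (n + 1) → SetFormula n
  | ex {n : ℕ} : SetFormula (n + 1) → SetFormula n

/-- Simultaneous substitution in a term. -/
def SetTerm.subst {n m : ℕ} (σ : Fin n → SetTerm m) : SetTerm n → SetTerm m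
  | .var i => σ i
  | .pair s t => .pair (s.subst σ) (t.subst σ)

/-- Weakening of a term by a new variable `0`. -/
def SetTerm.up {n : ℕ} (t : SetTerm n) : SetTerm (n + 1) := t.subst fun i => .var i.succ

/-- The substitution `σ` under a quantifier. -/
def SetTerm.lift {n m : ℕ} (σ : Fin n → SetTerm m) : Fin (n + 1) → SetTerm (m + 1) :=
  Fin.cons (.var 0) fun i => (σ i).up

namespace SetFormula

/-- Capture-avoiding simultaneous substitution in a formula. -/
def subst : {n m : ℕ} → (Fin n → SetTerm m) → SetFormula n → SetFormula m
  | _, _, _, bot => bot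
  | _, _, σ, eq s t => eq (s.subst σ) (t.subst σ)
  | _, _, σ, mem s t => mem (s.subst σ) (t.subst σ)
  | _, _, σ, isSet s => isSet (s.subst σ)
  | _, _, σ, and φ ψ => and (φ.subst σ) (ψ.subst σ)
  | _, _, σ, or φ ψ => or (φ.subst σ) (ψ.subst σ)
  | _, _, σ, imp φ ψ => imp (φ.subst σ) (ψ.subst σ)
  | _, _, σ, all φ => all (φ.subst (SetTerm.lift σ))
  | _, _, σ, ex φ => ex (φ.subst (SetTerm.lift σ))

/-- Weakening of a formula by a new variable `0`. -/
def up {n : ℕ} (φ : SetFormula n) : SetFormula (n + 1) := φ.subst fun i => .var i.succ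

/-- Substitution of a term for the variable `0`. -/
def inst {n : ℕ} (φ : SetFormula (n + 1)) (t : SetTerm n) : SetFormula n :=
  φ.subst (Fin.cons t SetTerm.var)

def iff {n : ℕ} (φ ψ : SetFormula n) : SetFormula n := and (imp φ ψ) (imp ψ φ)

def not {n : ℕ} (φ : SetFormula n) : SetFormula n := imp φ bot

/-- Universal closure. -/
def closure : {n : ℕ} → SetFormula n → SetFormula 0
  | 0, φ => φ
  | _ + 1, φ => closure (all φ)

end SetFormula

/-- The term has type `k`, and all its subterms have the same type, when the variables have the
types `s`. -/
def SetTerm.HasType {n : ℕ} (s : Fin n → ℕ) : SetTerm n → ℕ → Prop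
  | .var i, k => s i = k
  | .pair t u, k => t.HasType s k ∧ u.HasType s k

namespace SetFormula

/-- The formula has a stratification that gives its free variables the types `s`. -/
def StratifiedBy : {n : ℕ} → (Fin n → ℕ) → SetFormula n → Prop
  | _, _, bot => True
  | _, s, eq t u => ∃ k, t.HasType s k ∧ u.HasType s k
  | _, s, mem t u => ∃ k, t.HasType s k ∧ u.HasType s (k + 1)
  | _, s, isSet t => ∃ k, t.HasType s k
  | _, s, and φ ψ => φ.StratifiedBy s ∧ ψ.StratifiedBy s
  | _, s, or φ ψ => φ.StratifiedBy s ∧ ψ.StratifiedBy s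
  | _, s, imp φ ψ => φ.StratifiedBy s ∧ ψ.StratifiedBy s
  | _, s, all φ => ∃ k : ℕ, φ.StratifiedBy (Fin.cons k s)
  | _, s, ex φ => ∃ k : ℕ, φ.StratifiedBy (Fin.cons k s)

def Stratified {n : ℕ} (φ : SetFormula n) : Prop := ∃ s : Fin n → ℕ, φ.StratifiedBy s

/-- There is a set `x` whose elements are the `z` with `φ(z)`.  Here `z` is the variable `0` of
`φ`, and the remaining variables are parameters. -/
def comprehension {n : ℕ} (φ : SetFormula (n + 1)) : SetFormula n :=
  ex (and (isSet (.var 0))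
    (all (iff (mem (.var 0) (.var 1))
      (φ.subst (Fin.cons (.var 0) fun i => .var i.succ.succ)))))

/-- `(S(x) ∧ S(y) ∧ ∀ z, (z ∈ x ↔ z ∈ y)) → x = y`. -/
def extensionality : SetFormula 2 :=
  imp (and (isSet (.var 0)) (and (isSet (.var 1))
      (all (iff (mem (.var 0) (.var 1)) (mem (.var 0) (.var 2))))))
    (eq (.var 0) (.var 1))

/-- `⟨x, y⟩ = ⟨x', y'⟩ → (x = x' ∧ y = y')`. -/
def orderedPair : SetFormula 4 :=
  imp (eq (.pair (.var 0) (.var 1)) (.pair (.var 2) (.var 3)))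
    (and (eq (.var 0) (.var 2)) (eq (.var 1) (.var 3)))

/-- `z ∈ x → S(x)`. -/
def sethood : SetFormula 2 := imp (mem (.var 0) (.var 1)) (isSet (.var 1))

end SetFormula

/-- The axioms of `(I)NFU`. -/
def nfuAxioms : Set (SetFormula 0) :=
  {SetFormula.extensionality.closure, SetFormula.orderedPair.closure,
    SetFormula.sethood.closure} ∪
  {ψ | ∃ (n : ℕ) (φ : SetFormula (n + 1)), φ.Stratified ∧ ψ = φ.comprehension.closure}

/-- The axioms of `(I)NF`: those of `(I)NFU` and `∀ x, S(x)`. -/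
def nfAxioms : Set (SetFormula 0) := nfuAxioms ∪ {.all (.isSet (.var 0))}

/-- Natural deduction for first-order logic with equality, from the axioms `Ax` and the
hypotheses in the list `Γ`; classical if `cl = true` and intuitionistic if `cl = false`. -/
inductive Derivable (cl : Bool) (Ax : Set (SetFormula 0)) :
    {n : ℕ} → List (SetFormula n) → SetFormula n → Prop
  | ax {n : ℕ} {Γ : List (SetFormula n)} {φ : SetFormula 0} :
      φ ∈ Ax → Derivable cl Ax Γ (φ.subst fun i => i.elim0)
  | hyp {n : ℕ} {Γ : List (SetFormula n)} {φ : SetFormula n} : φ ∈ Γ → Derivable cl Ax Γ φ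
  | botE {n : ℕ} {Γ : List (SetFormula n)} {φ : SetFormula n} :
      Derivable cl Ax Γ .bot → Derivable cl Ax Γ φ
  | andI {n : ℕ} {Γ : List (SetFormula n)} {φ ψ : SetFormula n} :
      Derivable cl Ax Γ φ → Derivable cl Ax Γ ψ → Derivable cl Ax Γ (.and φ ψ)
  | andE₁ {n : ℕ} {Γ : List (SetFormula n)} {φ ψ : SetFormula n} :
      Derivable cl Ax Γ (.and φ ψ) → Derivable cl Ax Γ φ
  | andE₂ {n : ℕ} {Γ : List (SetFormula n)} {φ ψ : SetFormula n} :
      Derivable cl Ax Γ (.and φ ψ) → Derivable cl Ax Γ ψ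
  | orI₁ {n : ℕ} {Γ : List (SetFormula n)} {φ ψ : SetFormula n} :
      Derivable cl Ax Γ φ → Derivable cl Ax Γ (.or φ ψ)
  | orI₂ {n : ℕ} {Γ : List (SetFormula n)} {φ ψ : SetFormula n} :
      Derivable cl Ax Γ ψ → Derivable cl Ax Γ (.or φ ψ)
  | orE {n : ℕ} {Γ : List (SetFormula n)} {φ ψ χ : SetFormula n} :
      Derivable cl Ax Γ (.or φ ψ) → Derivable cl Ax (φ :: Γ) χ → Derivable cl Ax (ψ :: Γ) χ →
      Derivable cl Ax Γ χ
  | impI {n : ℕ} {Γ : List (SetFormula n)} {φ ψ : SetFormula n} :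
      Derivable cl Ax (φ :: Γ) ψ → Derivable cl Ax Γ (.imp φ ψ)
  | impE {n : ℕ} {Γ : List (SetFormula n)} {φ ψ : SetFormula n} :
      Derivable cl Ax Γ (.imp φ ψ) → Derivable cl Ax Γ φ → Derivable cl Ax Γ ψ
  | allI {n : ℕ} {Γ : List (SetFormula n)} {φ : SetFormula (n + 1)} :
      Derivable cl Ax (Γ.map SetFormula.up) φ → Derivable cl Ax Γ (.all φ)
  | allE {n : ℕ} {Γ : List (SetFormula n)} {φ : SetFormula (n + 1)} (t : SetTerm n) :
      Derivable cl Ax Γ (.all φ) → Derivable cl Ax Γ (φ.inst t)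
  | exI {n : ℕ} {Γ : List (SetFormula n)} {φ : SetFormula (n + 1)} (t : SetTerm n) :
      Derivable cl Ax Γ (φ.inst t) → Derivable cl Ax Γ (.ex φ)
  | exE {n : ℕ} {Γ : List (SetFormula n)} {φ : SetFormula (n + 1)} {ψ : SetFormula n} :
      Derivable cl Ax Γ (.ex φ) → Derivable cl Ax (φ :: Γ.map SetFormula.up) ψ.up →
      Derivable cl Ax Γ ψ
  | eqI {n : ℕ} {Γ : List (SetFormula n)} (t : SetTerm n) : Derivable cl Ax Γ (.eq t t)
  | eqE {n : ℕ} {Γ : List (SetFormula n)} {s t : SetTerm n} (φ : SetFormula (n + 1)) :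
      Derivable cl Ax Γ (.eq s t) → Derivable cl Ax Γ (φ.inst s) → Derivable cl Ax Γ (φ.inst t)
  | em {n : ℕ} {Γ : List (SetFormula n)} (φ : SetFormula n) :
      cl = true → Derivable cl Ax Γ (.or φ φ.not)

/-! ## Categorical semantics -/

/-- A structure for the language of set theory in the categorical semantics of `C`. -/
structure SetStructure (C : Type u₁) [Category.{v₁} C] [HeytingCategory C] where
  carrier : C
  mem : Subobject (carrier ⨯ carrier)
  isSet : Subobject carrier
  pair : carrier ⨯ carrier ⟶ carrier

namespace SetStructure

variable {C : Type u₁} [Category.{v₁} C] [HeytingCategory C] (𝒰 : SetStructure C)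

/-- The `n`-fold power of the carrier, which interprets contexts of `n` variables. -/
def ctx (n : ℕ) : C := ∏ᶜ fun _ : Fin n => 𝒰.carrier

/-- The projection that forgets the variable `0`. -/
def drop (n : ℕ) : 𝒰.ctx (n + 1) ⟶ 𝒰.ctx n :=
  Pi.lift fun i : Fin n => Pi.π (fun _ : Fin (n + 1) => 𝒰.carrier) i.succ

/-- The interpretation of a term in context. -/
def term {n : ℕ} : SetTerm n → (𝒰.ctx n ⟶ 𝒰.carrier)
  | .var i => Pi.π (fun _ : Fin n => 𝒰.carrier) i
  | .pair s t => prod.lift (term s) (term t) ≫ 𝒰.pair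

/-- The interpretation of a formula in context. -/
def interp : {n : ℕ} → SetFormula n → Subobject (𝒰.ctx n)
  | n, .bot => botSub (𝒰.ctx n)
  | _, .eq s t => (Subobject.pullback (prod.lift (𝒰.term s) (𝒰.term t))).obj
      (Subobject.mk (diag 𝒰.carrier))
  | _, .mem s t => (Subobject.pullback (prod.lift (𝒰.term s) (𝒰.term t))).obj 𝒰.mem
  | _, .isSet s => (Subobject.pullback (𝒰.term s)).obj 𝒰.isSet
  | _, .and φ ψ => interp φ ⊓ interp ψ
  | _, .or φ ψ => supSub (interp φ) (interp ψ)
  | _, .imp φ ψ => himpSub (interp φ) (interp ψ)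
  | n, .all φ => forallSub (𝒰.drop n) (interp φ)
  | n, .ex φ => existsSub (𝒰.drop n) (interp φ)

/-- Validity of a formula. -/
def Valid {n : ℕ} (φ : SetFormula n) : Prop := 𝒰.interp φ = ⊤

/-- The structure satisfies every axiom in `Ax`. -/
def Models (Ax : Set (SetFormula 0)) : Prop := ∀ φ ∈ Ax, 𝒰.Valid φ

/-- Every theorem of the theory with axioms `Ax`, in classical logic if `cl = true` and in
intuitionistic logic if `cl = false`, is valid in the structure. -/
def Interprets (cl : Bool) (Ax : Set (SetFormula 0)) : Prop :=
  ∀ φ : SetFormula 0, Derivable cl Ax [] φ → 𝒰.Valid φ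

end SetStructure

namespace IMLUCategory

variable {M : Type u₁} [Category.{v₁} M] [HeytingCategory M]
  {N : Type u₂} [Category.{v₂} N] [HeytingCategory N] (K : IMLUCategory M N)

/-- The isomorphism `ι_A : A ≅ T A` of `M`, for an object `A` of `N`. -/
def iotaN (A : N) : K.incl.obj A ⟶ K.incl.obj (K.TN.obj A) :=
  K.ι.hom.app (K.incl.obj A) ≫ K.restrict.inv.app A

/-- The subobject `∈_A` of `A × P A` in `M`: the pullback of `⊆ᵀ_A` along `ι_A × id`. -/
def memSub (A : N) : Subobject (K.incl.obj A ⨯ K.incl.obj (K.P.obj A)) :=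
  haveI := K.heyting
  haveI := K.subMap_mono A
  haveI := mono_relMap K.incl (K.subMap A)
  (Subobject.pullback (prod.map (K.iotaN A) (𝟙 (K.incl.obj (K.P.obj A))))).obj
    (Subobject.mk (relMap K.incl (K.subMap A)))

/-- The structure on `U` determined by monos `mS : P U ⟶ U` and `mP : U × U ⟶ U` of `N`:
sethood is `mS`, membership is `(id × mS) ∘ ∈_U`, and pairing is `mP`. -/
def setStructure (mS : K.P.obj K.U ⟶ K.U) [Mono mS] (mP : K.U ⨯ K.U ⟶ K.U) :
    SetStructure M :=
  haveI := K.heyting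
  { carrier := K.incl.obj K.U
    mem := (Subobject.map (prod.map (𝟙 (K.incl.obj K.U)) (K.incl.map mS))).obj (K.memSub K.U)
    isSet := Subobject.mk (K.incl.map mS)
    pair := inv (prodComparison K.incl K.U K.U) ≫ K.incl.map mP }

end IMLUCategory

end

/-!
The structure is studied through its generalized elements: a formula is forced at a stage `X` of `M`
under an assignment of morphisms `X ⟶ U`, and the Kripke–Joyal clauses, which follow from the
adjunctions and the stability of covers, make forcing behave like truth.  Soundness of natural
deduction is then an induction on derivations, and the axioms other than comprehension unfold to the
uniqueness of classifying morphisms and the fact that the two structure maps are monic.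

Comprehension uses the stratification.  In `M` every level `Tᵏ U` is isomorphic to `U`, but in
general not by a morphism of `N`.  If a variable of type `k` is made to range over `Tᵐ⁻ᵏ U`, for a
fixed large `m`, then `u ∈ v` relates an element of `T (Tʲ U)` to an element of `Tʲ U`, and this
relation is the `j`-th iterate under `T` of `⊆ᵀ`, hence it lives in `N`.  Since the inclusion is a
Heyting functor, every stratified formula defines a subobject in `N` (`exists_definable`).  The
power object property gives a family of elements of `P (Tʲ U)` that classifies it, and this family
has to be moved to `P U` in `M`.  That is possible if the canonical morphism
`sigma : T P A ⟶ P T A`, which respects membership, is invertible.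

The isomorphism `μ : P T ≅ T P` is not assumed to respect membership, so the invertibility of
`sigma` (`isIso_sigma`) is the main point.  It is monic by extensionality.  Consider the monic
natural endomorphism `α = μ ≫ sigma` of `P T`; the naturality of `μ` and of the singleton morphisms
yields a natural `δ : T T ⟶ P T` with `α (δ c) = {c}`.  Write `H = T T` and `Q = P T`, so that `Q A`
is an object of subsets of `H A`; this is the setting of `PowerSystem`.

* At the terminal object `α` is the identity: truth values are fixed by `T`, so naturality along
  subterminal objects applies (`app_one_eq_id`).  Hence `α X` is inhabited iff `X` is.
* `α` preserves and reflects inclusion in subsets of the form `H D`, by naturality along `D ⟶ A` and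
  along the characteristic morphism of `D`, which sends `D` to the point (`sub_of_sub_comp_app`).
* `α (X × δ c) = α X × {c}` (`mem_prod_app_iff`).  Applied to `X = δ c` and the diagonal, this shows
  that `δ c` is a singleton `{d c}` (`exists_point`).
* Applied to `X × δ (c, q)`, for a truth value `q`, and the subset of the `(x, (c, q))` such that
  `x = c` implies `q`, it shows that `c ∈ α X` iff `d c ∈ X` (`mem_comp_app_iff`).

So `α` is the inverse image along the monic `d` and has the direct image as a section
(`exists_comp_app_eq_id`).  Therefore `sigma` is split epic, and it is an isomorphism.
-/

open HeytingCategory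

/-! ### Generalized elements of subobjects -/

namespace CategoryTheory.Subobject

variable {C : Type u₁} [Category.{v₁} C]

theorem le_iff_factors {X : C} {S S' : Subobject X} :
    S ≤ S' ↔ ∀ ⦃W : C⦄ (f : W ⟶ X), S.Factors f → S'.Factors f :=
  ⟨fun h _ f => factors_of_le f h, fun h => le_of_factors (h _ S.factors_self)⟩

theorem ext_factors {X : C} {S S' : Subobject X}
    (h : ∀ ⦃W : C⦄ (f : W ⟶ X), S.Factors f ↔ S'.Factors f) : S = S' :=
  le_antisymm (le_iff_factors.2 fun _ f => (h f).1) (le_iff_factors.2 fun _ f => (h f).2)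

theorem mk_factors_iff_exists {X Y Z : C} (f : Y ⟶ X) [Mono f] (g : Z ⟶ X) :
    (mk f).Factors g ↔ ∃ h : Z ⟶ Y, h ≫ f = g := Iff.rfl

theorem factors_iff_exists {X Z : C} (S : Subobject X) (g : Z ⟶ X) :
    S.Factors g ↔ ∃ h : Z ⟶ (S : C), h ≫ S.arrow = g := factors_iff _ _

theorem eq_top_iff_factors {X : C} {S : Subobject X} : S = ⊤ ↔ S.Factors (𝟙 X) := by
  constructor
  · rintro rfl
    exact top_factors _
  · intro h
    exact top_le_iff.1 (le_iff_factors.2 fun W f _ => by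
      simpa using factors_of_factors_right f h)

end CategoryTheory.Subobject

open CategoryTheory.Subobject

attribute [local simp] prod.lift_fst prod.lift_snd prod.lift_fst_assoc prod.lift_snd_assoc
  prod.map_fst prod.map_snd prod.map_fst_assoc prod.map_snd_assoc

/-! ### Covers -/

namespace IsCover

variable {C : Type u₁} [Category.{v₁} C]

theorem isIso_of_mono {X Y : C} {f : X ⟶ Y} (hf : IsCover f) [Mono f] : IsIso f :=
  hf (𝟙 _) f inferInstance (Category.id_comp f)

theorem of_isIso {X Y : C} (f : X ⟶ Y) [IsIso f] : IsCover f := by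
  intro Z g m _ h
  have : IsSplitEpi m := IsSplitEpi.mk' ⟨inv f ≫ g, by simp [h]⟩
  exact isIso_of_mono_of_isSplitEpi m

variable [HeytingCategory C]

/-- Covers can be pulled back, so every cover of a stage restricts to later stages. -/
theorem exists_lift {X Y Z : C} {f : X ⟶ Y} (hf : IsCover f) (g : Z ⟶ Y) :
    ∃ (V : C) (c : V ⟶ Z) (h : V ⟶ X), IsCover c ∧ h ≫ f = c ≫ g :=
  ⟨_, pullback.snd f g, pullback.fst f g,
    cover_of_isPullback (IsPullback.of_hasPullback f g) hf, pullback.condition⟩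

/-- Membership of a generalized element in a subobject is a local property. -/
theorem factors {X Y Z : C} {c : X ⟶ Y} (hc : IsCover c) {S : Subobject Z} {f : Y ⟶ Z}
    (h : S.Factors (c ≫ f)) : S.Factors f := by
  have h' : ((Subobject.pullback f).obj S).Factors c := (pullback_factors_iff _ _ _).2 h
  obtain ⟨g, hg⟩ := (factors_iff_exists _ _).1 h'
  have := hc g _ inferInstance hg
  have h2 : ((Subobject.pullback f).obj S).Factors (𝟙 Y) :=
    (factors_iff_exists _ _).2 ⟨inv ((Subobject.pullback f).obj S).arrow, by simp⟩
  simpa using (pullback_factors_iff _ _ _).1 h2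

theorem epi {X Y : C} {c : X ⟶ Y} (hc : IsCover c) : Epi c := by
  refine ⟨fun {Z} g h e => ?_⟩
  have := hc (equalizer.lift c e) (equalizer.ι g h) inferInstance (by simp)
  exact (cancel_epi (equalizer.ι g h)).1 (equalizer.condition g h)

theorem factorThruImage {X Y : C} (f : X ⟶ Y) : IsCover (factorThruImage f) := by
  intro Z g m _ e
  let F : MonoFactorisation f :=
    { I := Z, m := m ≫ image.ι f, e := g, fac := by simp [reassoc_of% e] }
  have : IsSplitEpi m := IsSplitEpi.mk' ⟨image.lift F, by
    rw [← cancel_mono (image.ι f)]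
    simpa [F] using image.lift_fac F⟩
  exact isIso_of_mono_of_isSplitEpi m

end IsCover

/-! ### Kripke–Joyal clauses -/

namespace HeytingCategory

variable {C : Type u₁} [Category.{v₁} C] [HeytingCategory C]

theorem imageSubobject_factors_iff {X Y W : C} (f : X ⟶ Y) (y : W ⟶ Y) :
    (imageSubobject f).Factors y ↔
      ∃ (V : C) (c : V ⟶ W) (x : V ⟶ X), IsCover c ∧ x ≫ f = c ≫ y := by
  constructor
  · intro h
    obtain ⟨k, hk⟩ := (mk_factors_iff_exists (image.ι f) y).1 h
    obtain ⟨V, c, x, hc, e⟩ := (IsCover.factorThruImage f).exists_lift k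
    refine ⟨V, c, x, hc, ?_⟩
    rw [← hk, ← reassoc_of% e, image.fac]
  · rintro ⟨V, c, x, hc, e⟩
    apply hc.factors
    rw [← e]
    exact imageSubobject_factors_comp_self f x

/-- The left adjoint is only given by its universal property; its stability under pullback comes
from that of images. -/
theorem existsSub_eq_imageSubobject {X Y : C} (f : X ⟶ Y) (S : Subobject X) :
    existsSub f S = imageSubobject (S.arrow ≫ f) := by
  apply le_antisymm
  · rw [existsSub_gc f _ _, le_iff_factors]
    intro W x hx
    obtain ⟨k, rfl⟩ := (factors_iff_exists _ _).1 hx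
    rw [pullback_factors_iff, Category.assoc]
    exact imageSubobject_factors_comp_self _ _
  · rw [le_iff_factors]
    intro W y hy
    obtain ⟨V, c, x, hc, e⟩ := (imageSubobject_factors_iff _ _).1 hy
    apply hc.factors
    rw [← e, ← Category.assoc, ← pullback_factors_iff]
    exact factors_of_le _ ((existsSub_gc f).le_u_l S) (factors_comp_arrow x)

theorem existsSub_factors_iff {X Y W : C} (f : X ⟶ Y) (S : Subobject X) (y : W ⟶ Y) :
    (existsSub f S).Factors y ↔
      ∃ (V : C) (c : V ⟶ W) (x : V ⟶ X), IsCover c ∧ S.Factors x ∧ x ≫ f = c ≫ y := by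
  rw [existsSub_eq_imageSubobject, imageSubobject_factors_iff]
  constructor
  · rintro ⟨V, c, x, hc, e⟩
    exact ⟨V, c, x ≫ S.arrow, hc, factors_comp_arrow x, by simpa using e⟩
  · rintro ⟨V, c, x, hc, hx, e⟩
    obtain ⟨k, rfl⟩ := (factors_iff_exists _ _).1 hx
    exact ⟨V, c, k, hc, by simpa using e⟩

theorem forallSub_factors_iff {X Y W : C} (f : X ⟶ Y) (S : Subobject X) (y : W ⟶ Y) :
    (forallSub f S).Factors y ↔
      ∀ ⦃V : C⦄ (g : V ⟶ W) (x : V ⟶ X), x ≫ f = g ≫ y → S.Factors x := by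
  constructor
  · intro h V g x e
    refine factors_of_le _ ((forallSub_gc f).l_u_le S) ?_
    rw [pullback_factors_iff, e]
    exact factors_of_factors_right g h
  · intro h
    have hle : imageSubobject y ≤ forallSub f S := by
      rw [← forallSub_gc f _ _, le_iff_factors]
      intro V x hx
      rw [pullback_factors_iff, imageSubobject_factors_iff] at hx
      obtain ⟨V', c, g, hc, e⟩ := hx
      exact hc.factors (h g (c ≫ x) (by simpa using e.symm))
    exact factors_of_le _ hle (by simpa using imageSubobject_factors_comp_self y (𝟙 W))

theorem himpSub_factors_iff {X W : C} (a b : Subobject X) (y : W ⟶ X) :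
    (himpSub a b).Factors y ↔
      ∀ ⦃V : C⦄ (g : V ⟶ W), a.Factors (g ≫ y) → b.Factors (g ≫ y) := by
  rw [himpSub, forallSub_factors_iff]
  constructor
  · intro h V g hg
    obtain ⟨k, hk⟩ := (factors_iff_exists _ _).1 hg
    have := h g k hk
    rwa [pullback_factors_iff, hk] at this
  · intro h V g x e
    rw [pullback_factors_iff, e]
    apply h
    rw [← e]
    exact factors_comp_arrow x

/-- The two subobjects of `W` can be taken to be the inverse images of `a` and `b`. -/
theorem supSub_factors_iff {X W : C} (a b : Subobject X) (y : W ⟶ X) :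
    (supSub a b).Factors y ↔
      ∃ s t : Subobject W, IsLUB {s, t} ⊤ ∧ a.Factors (s.arrow ≫ y) ∧ b.Factors (t.arrow ≫ y) := by
  constructor
  · intro h
    refine ⟨(Subobject.pullback y).obj a, (Subobject.pullback y).obj b, ?_, ?_, ?_⟩
    · have h1 := pullback_isLUB y a b _ (supSub_isLUB a b)
      have h2 : (Subobject.pullback y).obj (supSub a b) = ⊤ := by
        rw [eq_top_iff_factors, pullback_factors_iff]
        simpa using h
      rwa [h2] at h1
    · exact (pullback_factors_iff _ _ _).1 (factors_self _)
    · exact (pullback_factors_iff _ _ _).1 (factors_self _)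
  · rintro ⟨s, t, hst, hs, ht⟩
    have hu : (⊤ : Subobject W) ≤ (Subobject.pullback y).obj (supSub a b) := by
      refine hst.2 ?_
      have hab := (supSub_isLUB a b).1
      rintro _ (rfl | rfl)
      · exact le_of_factors ((pullback_factors_iff _ _ _).2
          (factors_of_le _ (hab (Set.mem_insert _ _)) hs))
      · exact le_of_factors ((pullback_factors_iff _ _ _).2
          (factors_of_le _ (hab (Set.mem_insert_of_mem _ rfl)) ht))
    have := eq_top_iff_factors.1 (top_le_iff.1 hu)
    simpa using (pullback_factors_iff _ _ _).1 this

/-- A property of generalized elements that holds on two subobjects with supremum `⊤` holds. -/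
theorem factors_of_isLUB_top {X W : C} {s t : Subobject W} (h : IsLUB {s, t} ⊤)
    {S : Subobject X} {y : W ⟶ X} (hs : S.Factors (s.arrow ≫ y)) (ht : S.Factors (t.arrow ≫ y)) :
    S.Factors y := by
  have : supSub S S = S :=
    (supSub_isLUB S S).unique (by simp)
  rw [← this]
  exact (supSub_factors_iff _ _ _).2 ⟨s, t, h, hs, ht⟩

/-- A stage at which the least subobject has an element forces everything. -/
theorem factors_of_botSub_factors {X Y W : C} {y : W ⟶ X} (h : (botSub X).Factors y)
    (S : Subobject Y) (z : W ⟶ Y) : S.Factors z := by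
  have h1 : (Subobject.pullback y).obj (botSub X) = ⊤ := by
    rw [eq_top_iff_factors, pullback_factors_iff]
    simpa using h
  have h2 := pullback_isBot y _ (botSub_isBot X) ((Subobject.pullback z).obj S)
  rw [h1] at h2
  simpa using (pullback_factors_iff _ _ _).1 (eq_top_iff_factors.1 (top_le_iff.1 h2))

end HeytingCategory

/-! ### Images of subobjects under functors -/

section MapSub

variable {C : Type u₁} [Category.{v₁} C] {D : Type u₂} [Category.{v₂} D]

section

variable (F : C ⥤ D) [PreservesFiniteLimits F]

theorem mapSub_factors_iff {X : C} (S : Subobject X) {W : D} (y : W ⟶ F.obj X) :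
    (mapSub F S).Factors y ↔ ∃ h : W ⟶ F.obj (S : C), h ≫ F.map S.arrow = y := Iff.rfl

theorem mapSub_mk {X Y : C} (m : Y ⟶ X) [Mono m] :
    mapSub F (Subobject.mk m) = Subobject.mk (F.map m) := by
  refine ext_factors fun W y => ?_
  rw [mapSub_factors_iff, mk_factors_iff_exists]
  constructor
  · rintro ⟨h, rfl⟩
    exact ⟨h ≫ F.map (underlyingIso m).hom, by
      rw [Category.assoc, ← F.map_comp, underlyingIso_hom_comp_eq_mk]⟩
  · rintro ⟨h, rfl⟩
    exact ⟨h ≫ F.map (underlyingIso m).inv, by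
      rw [Category.assoc, ← F.map_comp, underlyingIso_arrow]⟩

theorem mapSub_factors_map {X Y : C} {S : Subobject X} {x : Y ⟶ X} (h : S.Factors x) :
    (mapSub F S).Factors (F.map x) := by
  obtain ⟨k, rfl⟩ := (factors_iff_exists _ _).1 h
  exact ⟨F.map k, by simp⟩

theorem mapSub_pullback [HasPullbacks C] [HasPullbacks D] {X Y : C} (f : X ⟶ Y) (S : Subobject Y) :
    mapSub F ((Subobject.pullback f).obj S) = (Subobject.pullback (F.map f)).obj (mapSub F S) := by
  refine ext_factors fun W y => ?_
  have hp := (Subobject.isPullback f S).map F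
  rw [pullback_factors_iff, mapSub_factors_iff, mapSub_factors_iff]
  constructor
  · rintro ⟨h, rfl⟩
    exact ⟨h ≫ F.map (pullbackπ f S), by simp [hp.w]⟩
  · rintro ⟨h, e⟩
    exact ⟨hp.lift h y e, hp.lift_snd _ _ _⟩

theorem mapSub_mono {X : C} {S S' : Subobject X} (h : S ≤ S') : mapSub F S ≤ mapSub F S' := by
  rw [le_iff_factors]
  intro W y hy
  obtain ⟨k, rfl⟩ := (mapSub_factors_iff F S y).1 hy
  exact (mapSub_factors_iff F S' _).2 ⟨k ≫ F.map (ofLE S S' h), by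
    rw [Category.assoc, ← F.map_comp, ofLE_arrow]⟩

theorem mapSub_inf [HasPullbacks C] [HasPullbacks D] {X : C} (S S' : Subobject X) :
    mapSub F (S ⊓ S') = mapSub F S ⊓ mapSub F S' := by
  refine ext_factors fun W y => ?_
  rw [inf_factors]
  constructor
  · intro h
    exact ⟨factors_of_le _ (mapSub_mono F inf_le_left) h,
      factors_of_le _ (mapSub_mono F inf_le_right) h⟩
  · rintro ⟨hk, h⟩
    obtain ⟨k, rfl⟩ := (mapSub_factors_iff F S y).1 hk
    have h1 : ((Subobject.pullback (F.map S.arrow)).obj (mapSub F S')).Factors k :=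
      (pullback_factors_iff _ _ _).2 h
    rw [← mapSub_pullback] at h1
    obtain ⟨l, rfl⟩ := (mapSub_factors_iff F _ _).1 h1
    have h2 : (S ⊓ S').Factors (((Subobject.pullback S.arrow).obj S').arrow ≫ S.arrow) :=
      (inf_factors _).2 ⟨factors_comp_arrow _, (pullback_factors_iff _ _ _).1 (factors_self _)⟩
    have h3 := factors_of_factors_right l (mapSub_factors_map F h2)
    rwa [F.map_comp, ← Category.assoc] at h3

theorem mapSub_equalizerSubobject_factors_iff [HasFiniteLimits C] {X Y : C} (f g : X ⟶ Y)
    {W : D} (y : W ⟶ F.obj X) :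
    (mapSub F (equalizerSubobject f g)).Factors y ↔ y ≫ F.map f = y ≫ F.map g := by
  rw [equalizerSubobject, mapSub_mk, mk_factors_iff_exists]
  constructor
  · rintro ⟨h, rfl⟩
    rw [Category.assoc, Category.assoc, ← F.map_comp, ← F.map_comp, equalizer.condition]
  · intro e
    have hl := isLimitForkMapOfIsLimit F (equalizer.condition f g) (equalizerIsEqualizer f g)
    exact ⟨Fork.IsLimit.lift hl y e, Fork.IsLimit.lift_ι hl⟩

theorem hom_ext_map_prod [HasFiniteLimits C] {A B : C} {W : D} {x y : W ⟶ F.obj (A ⨯ B)}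
    (h₁ : x ≫ F.map prod.fst = y ≫ F.map prod.fst)
    (h₂ : x ≫ F.map prod.snd = y ≫ F.map prod.snd) : x = y := by
  rw [← cancel_mono (prodComparison F A B)]
  ext <;> simpa

/-- The generalized element of `F(A × B)` with the given components. -/
noncomputable def liftMap [HasFiniteLimits C] [HasFiniteLimits D] {A B : C} {W : D}
    (x : W ⟶ F.obj A) (y : W ⟶ F.obj B) : W ⟶ F.obj (A ⨯ B) :=
  prod.lift x y ≫ inv (prodComparison F A B)

section

variable [HasFiniteLimits C] [HasFiniteLimits D] {A B : C} {W : D}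

@[simp]
theorem liftMap_fst (x : W ⟶ F.obj A) (y : W ⟶ F.obj B) : liftMap F x y ≫ F.map prod.fst = x := by
  rw [liftMap, Category.assoc, inv_prodComparison_map_fst, prod.lift_fst]

@[simp]
theorem liftMap_snd (x : W ⟶ F.obj A) (y : W ⟶ F.obj B) : liftMap F x y ≫ F.map prod.snd = y := by
  rw [liftMap, Category.assoc, inv_prodComparison_map_snd, prod.lift_snd]

@[simp]
theorem liftMap_fst_assoc (x : W ⟶ F.obj A) (y : W ⟶ F.obj B) {Z : D} (h : F.obj A ⟶ Z) :
    liftMap F x y ≫ F.map prod.fst ≫ h = x ≫ h := by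
  rw [← Category.assoc, liftMap_fst]

@[simp]
theorem liftMap_snd_assoc (x : W ⟶ F.obj A) (y : W ⟶ F.obj B) {Z : D} (h : F.obj B ⟶ Z) :
    liftMap F x y ≫ F.map prod.snd ≫ h = y ≫ h := by
  rw [← Category.assoc, liftMap_snd]

theorem comp_liftMap {V : D} (g : V ⟶ W) (x : W ⟶ F.obj A) (y : W ⟶ F.obj B) :
    g ≫ liftMap F x y = liftMap F (g ≫ x) (g ≫ y) :=
  hom_ext_map_prod F (by simp) (by simp)

theorem liftMap_prod_map {A' B' : C} (f : A ⟶ A') (g : B ⟶ B') (x : W ⟶ F.obj A)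
    (y : W ⟶ F.obj B) :
    liftMap F x y ≫ F.map (prod.map f g) = liftMap F (x ≫ F.map f) (y ≫ F.map g) := by
  apply hom_ext_map_prod F
  · rw [Category.assoc, ← F.map_comp, prod.map_fst, F.map_comp, liftMap_fst_assoc, liftMap_fst]
  · rw [Category.assoc, ← F.map_comp, prod.map_snd, F.map_comp, liftMap_snd_assoc, liftMap_snd]

theorem map_prod_lift {Y : C} (x : Y ⟶ A) (y : Y ⟶ B) :
    F.map (prod.lift x y) = liftMap F (F.map x) (F.map y) :=
  hom_ext_map_prod F (by rw [liftMap_fst, ← F.map_comp, prod.lift_fst])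
    (by rw [liftMap_snd, ← F.map_comp, prod.lift_snd])

end

/-- If `F' ⋙ F ≅ F`, then the images under `F` of `F'(S)` and of `S` correspond to each other under
the isomorphism. -/
theorem mapSub_comp_factors_iff {F' : C ⥤ C} [PreservesFiniteLimits F'] (e : F' ⋙ F ≅ F) {X : C}
    (S : Subobject X) {W : D} (y : W ⟶ F.obj (F'.obj X)) :
    (mapSub F (mapSub F' S)).Factors y ↔ (mapSub F S).Factors (y ≫ e.hom.app X) := by
  rw [show mapSub F (mapSub F' S) = Subobject.mk (F.map (F'.map S.arrow)) from mapSub_mk F _,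
    mk_factors_iff_exists, mapSub_factors_iff]
  constructor
  · rintro ⟨h, rfl⟩
    exact ⟨h ≫ e.hom.app _, by
      rw [Category.assoc, Category.assoc]
      exact congrArg (h ≫ ·) (e.hom.naturality S.arrow).symm⟩
  · rintro ⟨h, e'⟩
    refine ⟨h ≫ e.inv.app _, ?_⟩
    have := e.inv.naturality S.arrow
    simp only [Functor.comp_map] at this
    rw [Category.assoc, ← this, reassoc_of% e']
    simp

end

section Conservative

variable [HeytingCategory C] [HeytingCategory D] (F : C ⥤ D) [IsHeytingFunctor F]

theorem mapSub_himpSub {X : C} (a b : Subobject X) :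
    mapSub F (himpSub a b) = himpSub (mapSub F a) (mapSub F b) := by
  rw [himpSub, IsHeytingFunctor.map_forall]
  refine ext_factors fun W y => ?_
  rw [forallSub_factors_iff, himpSub_factors_iff, mapSub_pullback]
  constructor
  · intro h V g hg
    obtain ⟨k, hk⟩ := (mapSub_factors_iff F a _).1 hg
    have := h g k hk
    rwa [pullback_factors_iff, hk] at this
  · intro h V g x e
    rw [pullback_factors_iff, e]
    refine h g ⟨x, e⟩

end Conservative

section Reflects

variable [HasFiniteLimits C] [HasFiniteLimits D] (F : C ⥤ D) [F.ReflectsIsomorphisms]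
  [PreservesFiniteLimits F]

/-- A conservative functor reflects inclusions, because it reflects that the inclusion of `a ⊓ b`
into `a` is invertible. -/
theorem le_of_mapSub_le {X : C} {a b : Subobject X} (h : mapSub F a ≤ mapSub F b) : a ≤ b := by
  have h1 : (mapSub F ((Subobject.pullback a.arrow).obj b)) = ⊤ := by
    rw [mapSub_pullback, eq_top_iff_factors, pullback_factors_iff]
    exact factors_of_le _ h ⟨𝟙 _, rfl⟩
  have h2 : IsIso (F.map ((Subobject.pullback a.arrow).obj b).arrow) :=
    (Subobject.isIso_iff_mk_eq_top _).2 h1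
  have h3 := isIso_of_reflects_iso ((Subobject.pullback a.arrow).obj b).arrow F
  have h4 := (Subobject.isIso_arrow_iff_eq_top _).1 h3
  rw [eq_top_iff_factors, pullback_factors_iff] at h4
  exact le_of_factors (by simpa using h4)

theorem mapSub_injective {X : C} :
    Function.Injective (mapSub F : Subobject X → _) := fun _ _ h =>
  le_antisymm (le_of_mapSub_le F h.le) (le_of_mapSub_le F h.ge)

end Reflects

end MapSub

/-! ### Power objects relative to a functor -/

/-- Power objects relative to an endofunctor `H`: the object `Q A` classifies, by means of the
membership relation `mem A`, the relations on `H A`, and `Q` acts on morphisms by direct images. -/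
structure PowerSystem {N : Type u₂} [Category.{v₂} N] [HeytingCategory N] (H Q : N ⥤ N) where
  /-- The membership relation. -/
  mem : ∀ A : N, Subobject (H.obj A ⨯ Q.obj A)
  ext : ∀ {A B : N} (X Y : B ⟶ Q.obj A),
    (Subobject.pullback (prod.map (𝟙 (H.obj A)) X)).obj (mem A) =
      (Subobject.pullback (prod.map (𝟙 (H.obj A)) Y)).obj (mem A) → X = Y
  exists_class : ∀ {A B : N} (R : Subobject (H.obj A ⨯ B)), ∃ χ : B ⟶ Q.obj A,
    (Subobject.pullback (prod.map (𝟙 (H.obj A)) χ)).obj (mem A) = R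
  map : ∀ {A B : N} (f : A ⟶ B),
    (Subobject.pullback (prod.map (𝟙 (H.obj B)) (Q.map f))).obj (mem B) =
      existsSub (prod.map (H.map f) (𝟙 (Q.obj A))) (mem A)

namespace PowerSystem

variable {N : Type u₂} [Category.{v₂} N] [HeytingCategory N] {H Q : N ⥤ N}

/-- The power system whose value at `A` is that of the given one at `G A`. -/
def whisker (p : PowerSystem H Q) (G : N ⥤ N) : PowerSystem (G ⋙ H) (G ⋙ Q) where
  mem A := p.mem (G.obj A)
  ext := p.ext
  exists_class := p.exists_class
  map f := p.map (G.map f)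

variable (p : PowerSystem H Q)

/-- The generalized element `x` of `H A` is a member of the generalized element `X` of `Q A`. -/
def Mem {A W : N} (x : W ⟶ H.obj A) (X : W ⟶ Q.obj A) : Prop := (p.mem A).Factors (prod.lift x X)

variable {p}

theorem Mem.comp {A V W : N} {x : W ⟶ H.obj A} {X : W ⟶ Q.obj A} (h : p.Mem x X) (g : V ⟶ W) :
    p.Mem (g ≫ x) (g ≫ X) := by
  unfold Mem
  rw [← prod.comp_lift]
  exact factors_of_factors_right g h

theorem mem_of_isCover {A V W : N} {x : W ⟶ H.obj A} {X : W ⟶ Q.obj A} {c : V ⟶ W}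
    (hc : IsCover c) (h : p.Mem (c ≫ x) (c ≫ X)) : p.Mem x X := by
  unfold Mem at h
  rw [← prod.comp_lift] at h
  exact hc.factors h

variable (p)

theorem pullback_mem_factors_iff {A B W : N} (X : B ⟶ Q.obj A) (x : W ⟶ H.obj A) (g : W ⟶ B) :
    ((Subobject.pullback (prod.map (𝟙 (H.obj A)) X)).obj (p.mem A)).Factors (prod.lift x g) ↔
      p.Mem x (g ≫ X) := by
  rw [pullback_factors_iff, prod.lift_map, Category.comp_id, Mem]

theorem hom_ext {A B : N} {X Y : B ⟶ Q.obj A}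
    (h : ∀ ⦃W : N⦄ (g : W ⟶ B) (x : W ⟶ H.obj A), p.Mem x (g ≫ X) ↔ p.Mem x (g ≫ Y)) : X = Y := by
  apply p.ext
  refine ext_factors fun W z => ?_
  have hz : z = prod.lift (z ≫ prod.fst) (z ≫ prod.snd) := by
    ext <;> simp
  rw [hz, pullback_mem_factors_iff, pullback_mem_factors_iff, h]

theorem exists_hom {A B : N} (R : Subobject (H.obj A ⨯ B)) : ∃ χ : B ⟶ Q.obj A,
    ∀ ⦃W : N⦄ (g : W ⟶ B) (x : W ⟶ H.obj A), p.Mem x (g ≫ χ) ↔ R.Factors (prod.lift x g) := by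
  obtain ⟨χ, rfl⟩ := p.exists_class R
  exact ⟨χ, fun W g x => (p.pullback_mem_factors_iff χ x g).symm⟩

theorem mem_map_iff {A B W : N} (f : A ⟶ B) (X : W ⟶ Q.obj A) (y : W ⟶ H.obj B) :
    p.Mem y (X ≫ Q.map f) ↔ ∃ (V : N) (c : V ⟶ W) (x : V ⟶ H.obj A),
      IsCover c ∧ p.Mem x (c ≫ X) ∧ x ≫ H.map f = c ≫ y := by
  rw [← pullback_mem_factors_iff, p.map, existsSub_factors_iff]
  constructor
  · rintro ⟨V, c, z, hc, hz, e⟩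
    have e1 : z ≫ prod.fst ≫ H.map f = c ≫ y := by
      have := e =≫ prod.fst
      simpa using this
    have e2 : z ≫ prod.snd = c ≫ X := by
      have := e =≫ prod.snd
      simpa using this
    refine ⟨V, c, z ≫ prod.fst, hc, ?_, by simpa using e1⟩
    rw [← e2, Mem]
    convert hz using 1
    ext <;> simp
  · rintro ⟨V, c, x, hc, hx, e⟩
    exact ⟨V, c, prod.lift x (c ≫ X), hc, hx, by simp [e]⟩

theorem mem_map {A B W : N} (f : A ⟶ B) {X : W ⟶ Q.obj A} {x : W ⟶ H.obj A} (h : p.Mem x X) :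
    p.Mem (x ≫ H.map f) (X ≫ Q.map f) :=
  (p.mem_map_iff f X _).2 ⟨W, 𝟙 W, x, IsCover.of_isIso _, by simpa using h, by simp⟩

theorem exists_singleton (A : N) : ∃ s : H.obj A ⟶ Q.obj A,
    ∀ ⦃W : N⦄ (a x : W ⟶ H.obj A), p.Mem x (a ≫ s) ↔ x = a := by
  obtain ⟨s, hs⟩ := p.exists_hom (A := A) (Subobject.mk (diag (H.obj A)))
  refine ⟨s, fun W a x => ?_⟩
  rw [hs, mk_factors_iff_exists]
  constructor
  · rintro ⟨h, e⟩
    have e1 := e =≫ prod.fst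
    have e2 := e =≫ prod.snd
    simp at e1 e2
    rw [← e1, ← e2]
  · rintro rfl
    exact ⟨x, by ext <;> simp⟩

/-- The singleton morphism. -/
noncomputable def sing (A : N) : H.obj A ⟶ Q.obj A := (p.exists_singleton A).choose

theorem mem_sing_iff {A W : N} (a x : W ⟶ H.obj A) : p.Mem x (a ≫ p.sing A) ↔ x = a :=
  (p.exists_singleton A).choose_spec a x

instance sing_mono (A : N) : Mono (p.sing A) :=
  ⟨fun a b e => by rw [← p.mem_sing_iff, ← e, p.mem_sing_iff]⟩

theorem sing_naturality {A B : N} (f : A ⟶ B) :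
    H.map f ≫ p.sing B = p.sing A ≫ Q.map f := by
  refine p.hom_ext fun W g y => ?_
  rw [← Category.assoc, mem_sing_iff, ← Category.assoc, mem_map_iff]
  constructor
  · rintro rfl
    exact ⟨W, 𝟙 W, g, IsCover.of_isIso _, by simp [mem_sing_iff], by simp⟩
  · rintro ⟨V, c, x, hc, hx, e⟩
    rw [← Category.assoc, mem_sing_iff] at hx
    have := hc.epi
    rw [← cancel_epi c, ← e, hx, Category.assoc]

/-! ### Natural endomorphisms of relative power objects -/

/-- The set `X` consists of elements of the subset `D` of `H A`. -/
def Sub {A W : N} (X : W ⟶ Q.obj A) (D : Subobject (H.obj A)) : Prop :=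
  ∀ ⦃V : N⦄ (g : V ⟶ W) (x : V ⟶ H.obj A), p.Mem x (g ≫ X) → D.Factors x

/-- The set `X` is inhabited. -/
def Inhabited {A W : N} (X : W ⟶ Q.obj A) : Prop :=
  ∃ (V : N) (c : V ⟶ W) (x : V ⟶ H.obj A), IsCover c ∧ p.Mem x (c ≫ X)

variable {p}

theorem Inhabited.comp {A V W : N} {X : W ⟶ Q.obj A} (h : p.Inhabited X) (g : V ⟶ W) :
    p.Inhabited (g ≫ X) := by
  obtain ⟨V', c, x, hc, hx⟩ := h
  obtain ⟨V'', c', g', hc', e⟩ := hc.exists_lift g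
  refine ⟨V'', c', g' ≫ x, hc', ?_⟩
  rw [← Category.assoc, ← e, Category.assoc]
  exact hx.comp g'

variable (p) [PreservesFiniteLimits H]

theorem exists_eq_map_of_sub {A B W : N} (i : B ⟶ A) [Mono i] (X : W ⟶ Q.obj A)
    (h : p.Sub X (Subobject.mk (H.map i))) : ∃ Z : W ⟶ Q.obj B, Z ≫ Q.map i = X := by
  obtain ⟨Z, hZ⟩ := p.exists_hom (A := B)
    ((Subobject.pullback (prod.map (H.map i) X)).obj (p.mem A))
  have hZ' : ∀ ⦃V : N⦄ (g : V ⟶ W) (y : V ⟶ H.obj B),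
      p.Mem y (g ≫ Z) ↔ p.Mem (y ≫ H.map i) (g ≫ X) := by
    intro V g y
    rw [hZ, pullback_factors_iff, prod.lift_map, Mem]
  refine ⟨Z, p.hom_ext fun V g x => ?_⟩
  rw [← Category.assoc, mem_map_iff]
  constructor
  · rintro ⟨V', c, y, hc, hy, e⟩
    rw [← Category.assoc, hZ', e, Category.assoc] at hy
    exact mem_of_isCover hc hy
  · intro hx
    obtain ⟨y, rfl⟩ := (mk_factors_iff_exists _ _).1 (h g x hx)
    exact ⟨V, 𝟙 V, y, IsCover.of_isIso _, by simpa [hZ'] using hx, by simp⟩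

theorem sub_map {A B W : N} (i : B ⟶ A) [Mono i] (Z : W ⟶ Q.obj B) :
    p.Sub (Z ≫ Q.map i) (Subobject.mk (H.map i)) := by
  intro V g x hx
  rw [← Category.assoc, mem_map_iff] at hx
  obtain ⟨V', c, y, hc, -, e⟩ := hx
  apply hc.factors
  rw [← e]
  exact (mk_factors_iff_exists _ _).2 ⟨y, rfl⟩

section Endomorphism

variable (α : Q ⟶ Q)

theorem Sub.app {A B W : N} {i : B ⟶ A} [Mono i] {X : W ⟶ Q.obj A}
    (h : p.Sub X (Subobject.mk (H.map i))) : p.Sub (X ≫ α.app A) (Subobject.mk (H.map i)) := by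
  obtain ⟨Z, rfl⟩ := p.exists_eq_map_of_sub i X h
  rw [Category.assoc, α.naturality, ← Category.assoc]
  exact p.sub_map i _

end Endomorphism

end PowerSystem

namespace PowerSystem

variable {N : Type u₂} [Category.{v₂} N] [HeytingCategory N] {H Q : N ⥤ N}
variable (p : PowerSystem H Q)

/-- Cartesian products of sets. -/
theorem exists_prod {A B W : N} (X : W ⟶ Q.obj A) (Y : W ⟶ Q.obj B) :
    ∃ Z : W ⟶ Q.obj (A ⨯ B), ∀ ⦃V : N⦄ (g : V ⟶ W) (z : V ⟶ H.obj (A ⨯ B)),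
      p.Mem z (g ≫ Z) ↔
        p.Mem (z ≫ H.map prod.fst) (g ≫ X) ∧ p.Mem (z ≫ H.map prod.snd) (g ≫ Y) := by
  obtain ⟨Z, hZ⟩ := p.exists_hom (A := A ⨯ B)
    ((Subobject.pullback (prod.map (H.map prod.fst) X)).obj (p.mem A) ⊓
      (Subobject.pullback (prod.map (H.map prod.snd) Y)).obj (p.mem B))
  refine ⟨Z, fun V g z => ?_⟩
  rw [hZ, inf_factors, pullback_factors_iff, pullback_factors_iff, prod.lift_map, prod.lift_map]
  rfl

/-- Unique choice: an inhabited subsingleton is a singleton. -/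
theorem exists_comp_sing_eq {A W : N} {X : W ⟶ Q.obj A} (hX : p.Inhabited X)
    (hX' : ∀ ⦃V : N⦄ (g : V ⟶ W) (x y : V ⟶ H.obj A), p.Mem x (g ≫ X) → p.Mem y (g ≫ X) → x = y) :
    ∃ d : W ⟶ H.obj A, d ≫ p.sing A = X := by
  let S : Subobject (H.obj A ⨯ W) := (Subobject.pullback (prod.map (𝟙 _) X)).obj (p.mem A)
  have hS : ∀ ⦃V : N⦄ (z : V ⟶ H.obj A ⨯ W),
      S.Factors z ↔ p.Mem (z ≫ prod.fst) ((z ≫ prod.snd) ≫ X) := by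
    intro V z
    rw [← pullback_mem_factors_iff]
    congr!
    ext <;> simp
  let π : (S : N) ⟶ W := S.arrow ≫ prod.snd
  have : Mono π := by
    refine ⟨fun {V} a b e => ?_⟩
    rw [← cancel_mono S.arrow]
    have ha := (hS _).1 (factors_comp_arrow a)
    have hb := (hS _).1 (factors_comp_arrow b)
    have e' : (a ≫ S.arrow) ≫ prod.snd = (b ≫ S.arrow) ≫ prod.snd := by simpa [π] using e
    rw [← e'] at hb
    ext
    · exact hX' _ _ _ ha hb
    · exact e'
  obtain ⟨V, c, x, hc, hx⟩ := hX
  obtain ⟨k, hk⟩ := (factors_iff_exists S (prod.lift x c)).1 ((hS _).2 (by simpa using hx))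
  have hπ : IsCover π := by
    intro Z g m _ e
    refine hc (k ≫ g) m inferInstance ?_
    rw [Category.assoc, e, ← Category.assoc, hk, prod.lift_snd]
  have := hπ.isIso_of_mono
  have hd : p.Mem (inv π ≫ S.arrow ≫ prod.fst) X := by
    have := (hS _).1 (factors_comp_arrow (inv π))
    rw [show (inv π ≫ S.arrow) ≫ prod.snd = 𝟙 W by simp [π]] at this
    simpa using this
  refine ⟨inv π ≫ S.arrow ≫ prod.fst, p.hom_ext fun V g x => ?_⟩
  rw [← Category.assoc, mem_sing_iff]
  constructor
  · rintro rfl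
    exact hd.comp g
  · intro hx
    exact hX' g _ _ hx (hd.comp g)

variable [PreservesFiniteLimits H]

/-- `H` preserves the terminal object. -/
noncomputable def isTerminalOne (H : N ⥤ N) [PreservesFiniteLimits H] :
    IsTerminal (H.obj (⊤_ N)) :=
  IsTerminal.isTerminalObj H _ terminalIsTerminal

theorem eq_sing_of_mem_one {W : N} {x : W ⟶ H.obj (⊤_ N)} {X : W ⟶ Q.obj (⊤_ N)}
    (h : p.Mem x X) : X = x ≫ p.sing (⊤_ N) := by
  refine p.hom_ext fun V g y => ?_
  rw [← Category.assoc, mem_sing_iff, (isTerminalOne H).hom_ext y (g ≫ x)]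
  exact ⟨fun _ => rfl, fun _ => h.comp g⟩

theorem inhabited_iff_mem_one {A W : N} (X : W ⟶ Q.obj A) (y : W ⟶ H.obj (⊤_ N)) :
    p.Inhabited X ↔ p.Mem y (X ≫ Q.map (terminal.from A)) := by
  rw [mem_map_iff]
  constructor
  · rintro ⟨V, c, x, hc, hx⟩
    exact ⟨V, c, x, hc, hx, (isTerminalOne H).hom_ext _ _⟩
  · rintro ⟨V, c, x, hc, hx, -⟩
    exact ⟨V, c, x, hc, hx⟩

section

variable (α : Q ⟶ Q) (δ : H ⟶ Q)

variable {p α δ} in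
/-- The subterminal object `δ(*)` is of the form `H B`, so that naturality of `α` along `B ⟶ 1`
bounds `{*} = α(δ(*))` by it. -/
theorem mem_one (hδ : ∀ A, δ.app A ≫ α.app A = p.sing A)
    (hH : ∀ V : Subobject (H.obj (⊤_ N)), ∃ (B : N) (i : B ⟶ ⊤_ N) (_ : Mono i),
      Subobject.mk (H.map i) = V)
    {W : N} (x y : W ⟶ H.obj (⊤_ N)) : p.Mem x (y ≫ δ.app (⊤_ N)) := by
  obtain ⟨B, i, _, hV⟩ := hH
    ((Subobject.pullback (prod.lift (𝟙 _) (δ.app (⊤_ N)))).obj (p.mem (⊤_ N)))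
  have key : ∀ {V : N} (x : V ⟶ H.obj (⊤_ N)),
      (Subobject.mk (H.map i)).Factors x ↔ p.Mem x (x ≫ δ.app (⊤_ N)) := by
    intro V x
    rw [hV, pullback_factors_iff, prod.comp_lift, Category.comp_id]
    rfl
  have h1 : p.Sub (δ.app (⊤_ N)) (Subobject.mk (H.map i)) := by
    intro V g x hx
    rw [key, (isTerminalOne H).hom_ext x g]
    rwa [(isTerminalOne H).hom_ext x g] at hx
  have h2 := Sub.app p α h1
  rw [hδ] at h2
  obtain rfl := (isTerminalOne H).hom_ext x y
  rw [← key]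
  exact h2 x x ((p.mem_sing_iff _ _).2 rfl)

variable {p α δ} in
/-- At the terminal object, a set with an element is the singleton of that element, and `δ` agrees
with the singleton morphism. -/
theorem app_one_eq_id [∀ A, Mono (α.app A)] (hδ : ∀ A, δ.app A ≫ α.app A = p.sing A)
    (hH : ∀ V : Subobject (H.obj (⊤_ N)), ∃ (B : N) (i : B ⟶ ⊤_ N) (_ : Mono i),
      Subobject.mk (H.map i) = V) : α.app (⊤_ N) = 𝟙 (Q.obj (⊤_ N)) := by
  refine p.hom_ext fun W g x => ?_
  have hs : x ≫ δ.app _ = x ≫ p.sing (⊤_ N) := p.eq_sing_of_mem_one (mem_one hδ hH x x)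
  rw [Category.comp_id]
  constructor
  · intro h
    have h' := p.eq_sing_of_mem_one h
    rw [← hδ, ← Category.assoc, cancel_mono] at h'
    rw [h']
    exact mem_one hδ hH x x
  · intro h
    rw [p.eq_sing_of_mem_one h, ← hs, Category.assoc, hδ, mem_sing_iff]

end

section

variable {p} {α : Q ⟶ Q} (h1 : α.app (⊤_ N) = 𝟙 (Q.obj (⊤_ N)))

include h1

/-- Being inhabited is membership of the point in the direct image along `A ⟶ 1`, where `α` is the
identity. -/
theorem inhabited_comp_app_iff {A W : N} (X : W ⟶ Q.obj A) :
    p.Inhabited (X ≫ α.app A) ↔ p.Inhabited X := by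
  rw [p.inhabited_iff_mem_one _ ((isTerminalOne H).from W),
    p.inhabited_iff_mem_one _ ((isTerminalOne H).from W), Category.assoc, ← α.naturality, h1,
    Category.comp_id]

theorem inhabited_comp_of_eq_sing {δ : H ⟶ Q} (hδ : ∀ A, δ.app A ≫ α.app A = p.sing A) {A W : N}
    (c : W ⟶ H.obj A) : p.Inhabited (c ≫ δ.app A) := by
  rw [← inhabited_comp_app_iff h1, Category.assoc, hδ]
  exact ⟨W, 𝟙 W, c, IsCover.of_isIso _, by simp [mem_sing_iff]⟩

/-- `α` reflects inclusion in the subset `H D`: the characteristic morphism of `D` collapses `D` to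
the point `1`, over which `α` is the identity. -/
theorem sub_of_sub_comp_app [∀ A, Mono (α.app A)] {Ω : N} {t : ⊤_ N ⟶ Ω} {A W : N}
    {χ : A ⟶ Ω} {X : W ⟶ Q.obj A}
    (h : p.Sub (X ≫ α.app A) (mapSub H ((Subobject.pullback χ).obj (Subobject.mk t)))) :
    p.Sub X (mapSub H ((Subobject.pullback χ).obj (Subobject.mk t))) := by
  rw [mapSub_pullback, mapSub_mk] at h ⊢
  have hW : p.Sub ((X ≫ Q.map χ) ≫ α.app Ω) (Subobject.mk (H.map t)) := by
    intro V g y hy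
    rw [Category.assoc, α.naturality, ← Category.assoc X, ← Category.assoc, mem_map_iff] at hy
    obtain ⟨V', c, x, hc, hx, e⟩ := hy
    apply hc.factors
    rw [← e, ← pullback_factors_iff]
    exact h (c ≫ g) x (by simpa using hx)
  obtain ⟨Z, hZ⟩ := p.exists_eq_map_of_sub t _ hW
  have hZ' : Z ≫ Q.map t = X ≫ Q.map χ := by
    rw [← cancel_mono (α.app Ω), ← hZ, Category.assoc, α.naturality, h1, Category.id_comp]
  intro V g x hx
  rw [pullback_factors_iff]
  apply p.sub_map t Z g
  rw [hZ', ← Category.assoc]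
  exact p.mem_map χ hx

variable {δ : H ⟶ Q} (hδ : ∀ A, δ.app A ≫ α.app A = p.sing A)

include hδ

/-- `α (X × δ c) = α X × {c}`. -/
theorem mem_prod_app_iff {A B W : N} {X : W ⟶ Q.obj A} {c : W ⟶ H.obj B} {Z : W ⟶ Q.obj (A ⨯ B)}
    (hZ : ∀ ⦃V : N⦄ (g : V ⟶ W) (z : V ⟶ H.obj (A ⨯ B)), p.Mem z (g ≫ Z) ↔
      p.Mem (z ≫ H.map prod.fst) (g ≫ X) ∧ p.Mem (z ≫ H.map prod.snd) (g ≫ c ≫ δ.app B))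
    {V : N} (g : V ⟶ W) (z : V ⟶ H.obj (A ⨯ B)) :
    p.Mem z (g ≫ Z ≫ α.app _) ↔
      p.Mem (z ≫ H.map prod.fst) (g ≫ X ≫ α.app A) ∧ z ≫ H.map prod.snd = g ≫ c := by
  -- The first projection of `X × δ c` is `X`, because `δ c` is inhabited.
  have hfst : Z ≫ Q.map prod.fst = X := by
    refine p.hom_ext fun V g x => ?_
    rw [← Category.assoc, mem_map_iff]
    constructor
    · rintro ⟨V', k, z, hk, hz, e⟩
      rw [← Category.assoc, hZ, e, Category.assoc] at hz
      exact mem_of_isCover hk hz.1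
    · intro hx
      obtain ⟨V', k, y, hk, hy⟩ := inhabited_comp_of_eq_sing h1 hδ (g ≫ c)
      refine ⟨V', k, liftMap H (k ≫ x) y, hk, ?_, by simp⟩
      rw [← Category.assoc, hZ]
      simp only [liftMap_fst, liftMap_snd, Category.assoc] at hy ⊢
      exact ⟨hx.comp k, hy⟩
  have hfst' : Z ≫ α.app _ ≫ Q.map prod.fst = X ≫ α.app A := by
    rw [← α.naturality, ← Category.assoc, hfst]
  have hforward : ∀ ⦃V : N⦄ (g : V ⟶ W) (z : V ⟶ H.obj (A ⨯ B)), p.Mem z (g ≫ Z ≫ α.app _) →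
      p.Mem (z ≫ H.map prod.fst) (g ≫ X ≫ α.app A) ∧ z ≫ H.map prod.snd = g ≫ c := by
    intro V g z hz
    have hz1 := p.mem_map prod.fst hz
    rw [Category.assoc, Category.assoc, hfst'] at hz1
    refine ⟨hz1, ?_⟩
    have hX : p.Inhabited (g ≫ X) := by
      have : p.Inhabited ((g ≫ Z) ≫ α.app _) :=
        ⟨V, 𝟙 V, z, IsCover.of_isIso _, by simpa using hz⟩
      rw [inhabited_comp_app_iff h1] at this
      obtain ⟨V', k, y, hk, hy⟩ := this
      rw [← Category.assoc, hZ, Category.assoc] at hy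
      exact ⟨V', k, _, hk, hy.1⟩
    have hsnd : (g ≫ Z) ≫ Q.map prod.snd = g ≫ c ≫ δ.app B := by
      refine p.hom_ext fun V g' x => ?_
      rw [← Category.assoc, mem_map_iff]
      constructor
      · rintro ⟨V', k, z, hk, hz, e⟩
        rw [← Category.assoc, ← Category.assoc, hZ, e] at hz
        simp only [Category.assoc] at hz
        exact mem_of_isCover hk hz.2
      · intro hx
        obtain ⟨V', k, y, hk, hy⟩ := hX.comp g'
        refine ⟨V', k, liftMap H y (k ≫ x), hk, ?_, by simp⟩
        rw [← Category.assoc, ← Category.assoc, hZ]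
        simp only [liftMap_fst, liftMap_snd, Category.assoc] at hy ⊢
        exact ⟨hy, hx.comp k⟩
    have hz2 := p.mem_map prod.snd hz
    rw [Category.assoc, Category.assoc, ← α.naturality, ← Category.assoc Z, ← Category.assoc g,
      ← Category.assoc g, hsnd, Category.assoc, Category.assoc, hδ, ← Category.assoc,
      mem_sing_iff] at hz2
    exact hz2
  refine ⟨hforward g z, ?_⟩
  rintro ⟨hz1, hz2⟩
  rw [← hfst', ← Category.assoc, ← Category.assoc, mem_map_iff] at hz1
  obtain ⟨V', k, w, hk, hw, e⟩ := hz1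
  rw [Category.assoc, ← Category.assoc] at hw
  have hw2 := (hforward (k ≫ g) w hw).2
  have hwz : w = k ≫ z := hom_ext_map_prod H (by simpa using e) (by simp [hw2, hz2])
  apply mem_of_isCover hk
  rwa [← hwz, ← Category.assoc]

/-- The point of `δ`: since `α` reflects inclusion in the diagonal and `α (δ c × δ c)` is the
singleton of `(c, c)`, the inhabited set `δ c` has only one element. -/
theorem exists_point [∀ A, Mono (α.app A)] {Ω : N} {t : ⊤_ N ⟶ Ω}
    (hΩ : ∀ {A : N} (D : Subobject A), ∃ χ : A ⟶ Ω,
      (Subobject.pullback χ).obj (Subobject.mk t) = D) (A : N) :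
    ∃ d : H.obj A ⟶ H.obj A, d ≫ p.sing A = δ.app A := by
  have hinh := inhabited_comp_of_eq_sing h1 hδ (𝟙 (H.obj A))
  rw [Category.id_comp] at hinh
  refine p.exists_comp_sing_eq hinh fun W c x y hx hy => ?_
  obtain ⟨Z, hZ⟩ := p.exists_prod (c ≫ δ.app A) (c ≫ δ.app A)
  have hsub : p.Sub (Z ≫ α.app _) (mapSub H (equalizerSubobject prod.fst prod.snd)) := by
    intro V g z hz
    rw [mem_prod_app_iff h1 hδ hZ, Category.assoc, hδ, ← Category.assoc, mem_sing_iff] at hz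
    rw [mapSub_equalizerSubobject_factors_iff, hz.1, hz.2]
  obtain ⟨χ, hχ⟩ := hΩ (equalizerSubobject (prod.fst : A ⨯ A ⟶ A) prod.snd)
  rw [← hχ] at hsub
  have := sub_of_sub_comp_app h1 hsub (𝟙 W) (liftMap H x y)
    ((hZ _ _).2 ⟨by simpa using hx, by simpa using hy⟩)
  rw [hχ, mapSub_equalizerSubobject_factors_iff] at this
  simpa using this

end

end PowerSystem

namespace PowerSystem

variable {N : Type u₂} [Category.{v₂} N] [HeytingCategory N] {H Q : N ⥤ N}
  {p : PowerSystem H Q} [PreservesFiniteLimits H]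

/-- The set `α X` is the inverse image of `X` under the morphism `d` that represents `δ`: the
statement `c ∈ α X → q`, for an arbitrary truth value `q`, says that `α X × {(c, q)}` is
included in a subset of the form `H D`. -/
theorem mem_comp_app_iff {α : Q ⟶ Q} {δ : H ⟶ Q} [∀ A, Mono (α.app A)]
    (h1 : α.app (⊤_ N) = 𝟙 (Q.obj (⊤_ N))) (hδ : ∀ A, δ.app A ≫ α.app A = p.sing A)
    {Ω : N} {t : ⊤_ N ⟶ Ω}
    (hΩ : ∀ {A : N} (D : Subobject A), ∃ χ : A ⟶ Ω,
      (Subobject.pullback χ).obj (Subobject.mk t) = D)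
    (hHΩ : ∀ {W : N} (V : Subobject W), ∃ q : W ⟶ H.obj Ω,
      (Subobject.pullback q).obj (Subobject.mk (H.map t)) = V)
    (himp : ∀ {A : N} (a b : Subobject A),
      mapSub H (himpSub a b) = himpSub (mapSub H a) (mapSub H b))
    {d : ∀ A, H.obj A ⟶ H.obj A} (hd : ∀ A, d A ≫ p.sing A = δ.app A)
    {A W : N} (X : W ⟶ Q.obj A) (c : W ⟶ H.obj A) :
    p.Mem c (X ≫ α.app A) ↔ p.Mem (c ≫ d A) X := by
  have hreflect : ∀ {A W : N} {X : W ⟶ Q.obj A} (D : Subobject A),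
      p.Sub (X ≫ α.app A) (mapSub H D) ↔ p.Sub X (mapSub H D) := by
    intro A W X D
    constructor
    · obtain ⟨χ, hχ⟩ := hΩ D
      rw [← hχ]
      exact sub_of_sub_comp_app h1
    · exact Sub.app p α
  have hnat : ∀ {A B : N} (f : A ⟶ B), d A ≫ H.map f = H.map f ≫ d B := by
    intro A B f
    rw [← cancel_mono (p.sing B), Category.assoc, Category.assoc, hd, δ.naturality,
      sing_naturality, ← Category.assoc, hd]
  have hpt : ∀ {A W : N} (D : Subobject A) (y : W ⟶ H.obj A),
      (mapSub H D).Factors (y ≫ d A) ↔ (mapSub H D).Factors y := by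
    have hsing : ∀ {A W : N} (D : Subobject A) (y : W ⟶ H.obj A),
        p.Sub (y ≫ p.sing A) (mapSub H D) ↔ (mapSub H D).Factors y := by
      intro A W D y
      constructor
      · intro h
        exact h (𝟙 W) y (by simp [mem_sing_iff])
      · intro h V g x hx
        rw [← Category.assoc, mem_sing_iff] at hx
        rw [hx]
        exact factors_of_factors_right g h
    intro A W D y
    rw [← hsing, Category.assoc, hd, ← hreflect, Category.assoc, hδ, hsing]
  let D : Subobject (A ⨯ (A ⨯ Ω)) :=
    himpSub (equalizerSubobject prod.fst (prod.snd ≫ prod.fst))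
      ((Subobject.pullback (prod.snd ≫ prod.snd)).obj (Subobject.mk t))
  have hD : ∀ {V : N} (z : V ⟶ H.obj (A ⨯ (A ⨯ Ω))), (mapSub H D).Factors z ↔
      ∀ ⦃V' : N⦄ (g : V' ⟶ V),
        g ≫ z ≫ H.map prod.fst = g ≫ (z ≫ H.map prod.snd) ≫ H.map prod.fst →
        (mapSub H (Subobject.mk t)).Factors (g ≫ (z ≫ H.map prod.snd) ≫ H.map prod.snd) := by
    intro V z
    simp only [D, himp, himpSub_factors_iff, mapSub_equalizerSubobject_factors_iff,
      mapSub_pullback, pullback_factors_iff, Functor.map_comp, Category.assoc]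
  have key : ∀ q : W ⟶ H.obj Ω,
      (∀ ⦃V : N⦄ (g : V ⟶ W), p.Mem (g ≫ c) (g ≫ X ≫ α.app A) →
        (mapSub H (Subobject.mk t)).Factors (g ≫ q)) ↔
      ∀ ⦃V : N⦄ (g : V ⟶ W), p.Mem (g ≫ c ≫ d A) (g ≫ X) →
        (mapSub H (Subobject.mk t)).Factors (g ≫ q) := by
    intro q
    obtain ⟨Z, hZ⟩ := p.exists_prod X (liftMap H c q ≫ δ.app (A ⨯ Ω))
    have hL : (∀ ⦃V : N⦄ (g : V ⟶ W), p.Mem (g ≫ c) (g ≫ X ≫ α.app A) →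
        (mapSub H (Subobject.mk t)).Factors (g ≫ q)) ↔ p.Sub (Z ≫ α.app _) (mapSub H D) := by
      constructor
      · intro h V g z hz
        rw [mem_prod_app_iff h1 hδ hZ] at hz
        rw [hD, hz.2]
        intro V' g' e
        simp only [Category.assoc, liftMap_fst, liftMap_snd] at e ⊢
        rw [← Category.assoc]
        apply h
        have := hz.1.comp g'
        rw [e] at this
        simpa using this
      · intro h V g hg
        have := h g (liftMap H (g ≫ c) (g ≫ liftMap H c q))
          ((mem_prod_app_iff h1 hδ hZ _ _).2 ⟨by simpa using hg, by simp⟩)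
        rw [hD] at this
        simpa using this (𝟙 V)
    have hR : (∀ ⦃V : N⦄ (g : V ⟶ W), p.Mem (g ≫ c ≫ d A) (g ≫ X) →
        (mapSub H (Subobject.mk t)).Factors (g ≫ q)) ↔ p.Sub Z (mapSub H D) := by
      have hδ' : ∀ ⦃V : N⦄ (g : V ⟶ W) (y : V ⟶ H.obj (A ⨯ Ω)),
          p.Mem y (g ≫ liftMap H c q ≫ δ.app _) ↔ y = g ≫ liftMap H c q ≫ d _ := by
        intro V g y
        rw [← hd, ← Category.assoc, ← Category.assoc, mem_sing_iff, Category.assoc]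
      constructor
      · intro h V g z hz
        rw [hZ, hδ'] at hz
        rw [hD, hz.2]
        intro V' g' e
        simp only [Category.assoc, hnat, liftMap_fst_assoc, liftMap_snd_assoc] at e ⊢
        rw [← Category.assoc, ← Category.assoc, hpt, Category.assoc, ← Category.assoc]
        apply h
        have := hz.1.comp g'
        rw [e] at this
        simpa using this
      · intro h V g hg
        have := h g (liftMap H (g ≫ c ≫ d A) (g ≫ liftMap H c q ≫ d _))
          ((hZ _ _).2 ⟨by simpa using hg, by simp [hδ']⟩)
        rw [hD] at this
        have := this (𝟙 V) (by simp [hnat])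
        rw [← hpt]
        simpa [hnat] using this
    rw [hL, hR, hreflect]
  have hmem : ∀ {x : W ⟶ H.obj A} {Y : W ⟶ Q.obj A}, ∃ q : W ⟶ H.obj Ω, ∀ ⦃V : N⦄ (g : V ⟶ W),
      (mapSub H (Subobject.mk t)).Factors (g ≫ q) ↔ p.Mem (g ≫ x) (g ≫ Y) := by
    intro x Y
    obtain ⟨q, hq⟩ := hHΩ ((Subobject.pullback (prod.lift x Y)).obj (p.mem A))
    refine ⟨q, fun V g => ?_⟩
    rw [mapSub_mk, ← pullback_factors_iff, hq, pullback_factors_iff, prod.comp_lift, Mem]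
  constructor
  · intro h
    obtain ⟨q, hq⟩ := hmem (x := c ≫ d A) (Y := X)
    have := (hq (𝟙 W)).1 ((key q).2 (fun V g hg => (hq g).2 hg) (𝟙 W) (by simpa using h))
    simpa using this
  · intro h
    obtain ⟨q, hq⟩ := hmem (x := c) (Y := X ≫ α.app A)
    have := (hq (𝟙 W)).1 ((key q).1 (fun V g hg => (hq g).2 hg) (𝟙 W) (by simpa using h))
    simpa using this

/-- Direct images under the monic `d` are inverse to the inverse images that describe `α`, so they
form a section of `α`. -/
theorem exists_comp_app_eq_id {α : Q ⟶ Q} {δ : H ⟶ Q} [∀ A, Mono (α.app A)]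
    (h1 : α.app (⊤_ N) = 𝟙 (Q.obj (⊤_ N))) (hδ : ∀ A, δ.app A ≫ α.app A = p.sing A)
    {Ω : N} {t : ⊤_ N ⟶ Ω}
    (hΩ : ∀ {A : N} (D : Subobject A), ∃ χ : A ⟶ Ω,
      (Subobject.pullback χ).obj (Subobject.mk t) = D)
    (hHΩ : ∀ {W : N} (V : Subobject W), ∃ q : W ⟶ H.obj Ω,
      (Subobject.pullback q).obj (Subobject.mk (H.map t)) = V)
    (himp : ∀ {A : N} (a b : Subobject A),
      mapSub H (himpSub a b) = himpSub (mapSub H a) (mapSub H b)) (A : N) :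
    ∃ s : Q.obj A ⟶ Q.obj A, s ≫ α.app A = 𝟙 _ := by
  choose d hd using exists_point h1 hδ hΩ
  have hmono : Mono (d A) := by
    refine ⟨fun x y e => ?_⟩
    have := congrArg (· ≫ p.sing A ≫ α.app A) e
    simp only [Category.assoc] at this
    rwa [← Category.assoc (d A), hd, hδ, cancel_mono] at this
  obtain ⟨s, hs⟩ := p.exists_hom (existsSub (prod.map (d A) (𝟙 (Q.obj A))) (p.mem A))
  refine ⟨s, p.hom_ext fun W g x => ?_⟩
  rw [← Category.assoc, mem_comp_app_iff h1 hδ hΩ hHΩ himp hd, hs, existsSub_factors_iff,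
    Category.comp_id]
  constructor
  · rintro ⟨V, c, z, hc, hz, e⟩
    have e1 : z ≫ prod.fst = c ≫ x := by
      rw [← cancel_mono (d A)]
      simpa using e =≫ prod.fst
    have e2 : z ≫ prod.snd = c ≫ g := by simpa using e =≫ prod.snd
    apply mem_of_isCover hc
    rw [← e1, ← e2, Mem]
    convert hz using 1
    ext <;> simp
  · intro hx
    exact ⟨W, 𝟙 W, prod.lift x g, IsCover.of_isIso _, hx, by simp⟩

end PowerSystem

/-! ### The power system of a stratified category of classes -/

theorem CategoryTheory.Subobject.exists_isPullback_iff {C : Type u₁} [Category.{v₁} C]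
    {R X S Y : C} (r : R ⟶ X) (s : S ⟶ Y) [Mono r] [Mono s] (f : X ⟶ Y) :
    (∃ top, IsPullback top r s f) ↔
      ∀ ⦃W : C⦄ (x : W ⟶ X), (mk r).Factors x ↔ (mk s).Factors (x ≫ f) := by
  simp only [mk_factors_iff_exists]
  constructor
  · rintro ⟨top, h⟩ W x
    constructor
    · rintro ⟨k, rfl⟩
      exact ⟨k ≫ top, by rw [Category.assoc, Category.assoc, h.w]⟩
    · rintro ⟨k, e⟩
      exact ⟨h.lift k x e, h.lift_snd _ _ _⟩
  · intro h
    obtain ⟨top, e⟩ := (h r).1 ⟨𝟙 _, Category.id_comp _⟩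
    have hex : ∀ c : PullbackCone s f, ∃ k : c.pt ⟶ R, k ≫ r = c.snd := fun c =>
      (h c.snd).2 ⟨c.fst, c.condition⟩
    choose l hl using hex
    refine ⟨top, ⟨e⟩, ⟨PullbackCone.IsLimit.mk e l ?_ hl ?_⟩⟩
    · intro c
      rw [← cancel_mono s, Category.assoc, e, ← Category.assoc, hl, c.condition]
    · intro c m _ hm
      rw [← cancel_mono r, hm, hl]

theorem mk_relMap_factors_iff {M : Type u₁} [Category.{v₁} M] [HeytingCategory M]
    {N : Type u₂} [Category.{v₂} N] [HeytingCategory N] (F : N ⥤ M) [PreservesFiniteLimits F]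
    {A B R : N} (r : R ⟶ A ⨯ B) [Mono r] [Mono (relMap F r)] {W : M} (x : W ⟶ F.obj A)
    (y : W ⟶ F.obj B) :
    (Subobject.mk (relMap F r)).Factors (prod.lift x y) ↔
      (mapSub F (Subobject.mk r)).Factors (liftMap F x y) := by
  rw [mapSub_mk, mk_factors_iff_exists, mk_factors_iff_exists]
  refine exists_congr fun h => ?_
  rw [relMap, liftMap, IsIso.eq_comp_inv, Category.assoc]

namespace IMLUCategory

variable {M : Type u₁} [Category.{v₁} M] [HeytingCategory M]
  {N : Type u₂} [Category.{v₂} N] [HeytingCategory N] (K : IMLUCategory M N)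

instance : IsHeytingFunctor K.incl := K.heyting

instance : PreservesFiniteLimits K.incl := K.heyting.toPreservesFiniteLimits

instance : K.incl.Faithful := K.faithful

instance : K.incl.ReflectsIsomorphisms := K.conservative

/-- In `M`, the endofunctor `T` becomes isomorphic to the identity. -/
noncomputable def eps : K.TN ⋙ K.incl ≅ K.incl :=
  K.restrict ≪≫ Functor.isoWhiskerLeft K.incl K.ι.symm ≪≫ K.incl.rightUnitor

theorem iotaN_eq (A : N) : K.iotaN A = K.eps.inv.app A := by
  simp [iotaN, eps]

instance : PreservesFiniteLimits K.TN := by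
  have h : PreservesFiniteLimits (K.TN ⋙ K.incl) := preservesFiniteLimits_of_natIso K.eps.symm
  have := reflectsFiniteLimits_of_reflectsIsomorphisms K.incl
  exact ⟨fun J _ _ => ⟨fun {G} => preservesLimit_of_reflects_of_preserves K.TN K.incl⟩⟩

theorem mapSub_himpSub_TN {A : N} (a b : Subobject A) :
    mapSub K.TN (himpSub a b) = himpSub (mapSub K.TN a) (mapSub K.TN b) := by
  apply mapSub_injective K.incl
  refine ext_factors fun W y => ?_
  simp only [mapSub_comp_factors_iff K.incl K.eps, mapSub_himpSub, himpSub_factors_iff]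
  simp only [← Category.assoc]

theorem mapSub_existsSub_TN {A B : N} (f : A ⟶ B) (S : Subobject A) :
    mapSub K.TN (existsSub f S) = existsSub (K.TN.map f) (mapSub K.TN S) := by
  apply mapSub_injective K.incl
  refine ext_factors fun W y => ?_
  rw [mapSub_comp_factors_iff K.incl K.eps, IsHeytingFunctor.map_exists,
    IsHeytingFunctor.map_exists, existsSub_factors_iff, existsSub_factors_iff]
  have hnat : K.incl.map (K.TN.map f) ≫ K.eps.hom.app B = K.eps.hom.app A ≫ K.incl.map f :=
    K.eps.hom.naturality f
  constructor
  · rintro ⟨V, c, x, hc, hx, e⟩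
    refine ⟨V, c, x ≫ K.eps.inv.app A, hc, ?_, ?_⟩
    · rw [mapSub_comp_factors_iff K.incl K.eps]
      simpa using hx
    · rw [← cancel_mono (K.eps.hom.app B), Category.assoc, Category.assoc, hnat]
      simpa using e
  · rintro ⟨V, c, x, hc, hx, e⟩
    rw [mapSub_comp_factors_iff K.incl K.eps] at hx
    exact ⟨V, c, x ≫ K.eps.hom.app A, hc, hx, by rw [Category.assoc, ← hnat, reassoc_of% e]⟩

instance (A : N) : Mono (K.subMap A) :=
  haveI := K.subMap_mono A
  K.incl.mono_of_mono_map this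

instance {A B R : N} (r : R ⟶ A ⨯ B) [Mono r] : Mono (relMap K.incl r) := mono_relMap _ _

/-- The relation `⊆ᵀ_A`, as a subobject. -/
noncomputable def subRel (A : N) : Subobject (K.TN.obj A ⨯ K.P.obj A) := imageSubobject (K.subMap A)

theorem exists_isPullback_subMap_iff {A B R : N} (r : R ⟶ K.TN.obj A ⨯ B) [Mono r]
    (χ : K.incl.obj B ⟶ K.incl.obj (K.P.obj A)) :
    (∃ top, IsPullback top (relMap K.incl r) (relMap K.incl (K.subMap A))
      (prod.map (𝟙 (K.incl.obj (K.TN.obj A))) χ)) ↔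
    ∀ ⦃W : M⦄ (x : W ⟶ K.incl.obj (K.TN.obj A)) (g : W ⟶ K.incl.obj B),
      (mapSub K.incl (Subobject.mk r)).Factors (liftMap K.incl x g) ↔
        (mapSub K.incl (K.subRel A)).Factors (liftMap K.incl x (g ≫ χ)) := by
  rw [exists_isPullback_iff, subRel, imageSubobject_mono]
  constructor
  · intro h W x g
    rw [← mk_relMap_factors_iff, ← mk_relMap_factors_iff, h, prod.lift_map, Category.comp_id]
  · intro h W z
    have hz : z = prod.lift (z ≫ prod.fst) (z ≫ prod.snd) := by ext <;> simp
    rw [hz, prod.lift_map, Category.comp_id, mk_relMap_factors_iff, mk_relMap_factors_iff, h]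

/-- The power objects of a stratified category of classes, relative to `T`. -/
noncomputable def powerSystem : PowerSystem K.TN K.P where
  mem := K.subRel
  map := K.map_power
  ext {A B} X Y h := by
    let R := (Subobject.pullback (prod.map (𝟙 (K.TN.obj A)) X)).obj (K.subRel A)
    obtain ⟨χ, -, hχ⟩ := K.power R.arrow inferInstance
    have key : ∀ Z : B ⟶ K.P.obj A,
        R = (Subobject.pullback (prod.map (𝟙 (K.TN.obj A)) Z)).obj (K.subRel A) →
        K.incl.map Z = K.incl.map χ := by
      intro Z hZ
      apply hχ
      rw [exists_isPullback_subMap_iff]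
      intro W x g
      rw [mk_arrow, hZ, mapSub_pullback, pullback_factors_iff, liftMap_prod_map, K.incl.map_id,
        Category.comp_id]
    exact K.incl.map_injective ((key X rfl).trans (key Y h).symm)
  exists_class {A B} R := by
    obtain ⟨χ, h, -⟩ := K.power R.arrow inferInstance
    refine ⟨χ, mapSub_injective K.incl (ext_factors fun W z => ?_)⟩
    rw [exists_isPullback_subMap_iff] at h
    have hz : z = liftMap K.incl (z ≫ K.incl.map prod.fst) (z ≫ K.incl.map prod.snd) :=
      hom_ext_map_prod K.incl (by simp) (by simp)
    rw [mapSub_pullback, pullback_factors_iff, hz, liftMap_prod_map, ← h, mk_arrow, K.incl.map_id,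
      Category.comp_id]

/-- Extensionality for generalized elements of `P A` at stages in `M`. -/
theorem incl_hom_ext {A : N} {W : M} {X Y : W ⟶ K.incl.obj (K.P.obj A)}
    (h : ∀ ⦃V : M⦄ (g : V ⟶ W) (x : V ⟶ K.incl.obj (K.TN.obj A)),
      (mapSub K.incl (K.subRel A)).Factors (liftMap K.incl x (g ≫ X)) ↔
        (mapSub K.incl (K.subRel A)).Factors (liftMap K.incl x (g ≫ Y))) : X = Y := by
  -- The object `S` of pairs of sets with the same elements, formed in `N`.
  let E₁ := (Subobject.pullback (prod.map (𝟙 (K.TN.obj A))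
    (prod.fst : K.P.obj A ⨯ K.P.obj A ⟶ _))).obj (K.subRel A)
  let E₂ := (Subobject.pullback (prod.map (𝟙 (K.TN.obj A))
    (prod.snd : K.P.obj A ⨯ K.P.obj A ⟶ _))).obj (K.subRel A)
  let S := forallSub prod.snd (himpSub E₁ E₂ ⊓ himpSub E₂ E₁)
  have hS : S.arrow ≫ prod.fst = S.arrow ≫ prod.snd := by
    refine K.powerSystem.hom_ext fun V g x => ?_
    have := (forallSub_factors_iff _ _ _).1 (factors_self S) g (prod.lift x (g ≫ S.arrow))
      (by simp)
    rw [inf_factors, himpSub_factors_iff, himpSub_factors_iff] at this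
    have h1 := this.1 (𝟙 V)
    have h2 := this.2 (𝟙 V)
    simp only [Category.id_comp, E₁, E₂, pullback_factors_iff, prod.lift_map, Category.comp_id,
      Category.assoc] at h1 h2
    exact ⟨h1, h2⟩
  have hXY : (mapSub K.incl S).Factors (liftMap K.incl X Y) := by
    rw [IsHeytingFunctor.map_forall, forallSub_factors_iff]
    intro V g z e
    have hz : z = liftMap K.incl (z ≫ K.incl.map prod.fst) (g ≫ liftMap K.incl X Y) :=
      hom_ext_map_prod K.incl (by simp) (by simpa using e)
    rw [hz, mapSub_inf, mapSub_himpSub, mapSub_himpSub, inf_factors, himpSub_factors_iff,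
      himpSub_factors_iff]
    simp only [E₁, E₂, mapSub_pullback, pullback_factors_iff, comp_liftMap, liftMap_prod_map,
      K.incl.map_id, Category.comp_id, liftMap_fst, liftMap_snd]
    constructor
    · intro V' g'
      simpa using (h (g' ≫ g) (g' ≫ z ≫ K.incl.map prod.fst)).1
    · intro V' g'
      simpa using (h (g' ≫ g) (g' ≫ z ≫ K.incl.map prod.fst)).2
  obtain ⟨k, hk⟩ := (mapSub_factors_iff _ _ _).1 hXY
  have e := congrArg K.incl.map hS
  rw [K.incl.map_comp, K.incl.map_comp] at e
  calc X = liftMap K.incl X Y ≫ K.incl.map prod.fst := by simp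
    _ = liftMap K.incl X Y ≫ K.incl.map prod.snd := by
      rw [← hk, Category.assoc, e, Category.assoc]
    _ = Y := by simp

end IMLUCategory

/-! ### Comparison of `T P A` with `P T A` -/

namespace IMLUCategory

variable {M : Type u₁} [Category.{v₁} M] [HeytingCategory M]
  {N : Type u₂} [Category.{v₂} N] [HeytingCategory N] (K : IMLUCategory M N)

theorem exists_sigma (A : N) : ∃ s : K.TN.obj (K.P.obj A) ⟶ K.P.obj (K.TN.obj A),
    (Subobject.pullback (prod.map (𝟙 _) s)).obj (K.subRel (K.TN.obj A)) =
      (Subobject.pullback (liftMap K.TN prod.fst prod.snd)).obj (mapSub K.TN (K.subRel A)) :=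
  K.powerSystem.exists_class _

/-- The canonical morphism `T P A ⟶ P T A`, which classifies the relation `T(⊆ᵀ_A)`. -/
noncomputable def sigma (A : N) : K.TN.obj (K.P.obj A) ⟶ K.P.obj (K.TN.obj A) :=
  (K.exists_sigma A).choose

theorem pullback_sigma (A : N) :
    (Subobject.pullback (prod.map (𝟙 _) (K.sigma A))).obj (K.subRel (K.TN.obj A)) =
      (Subobject.pullback (liftMap K.TN prod.fst prod.snd)).obj (mapSub K.TN (K.subRel A)) :=
  (K.exists_sigma A).choose_spec

theorem mem_sigma_iff {A W : N} (x : W ⟶ K.TN.obj (K.TN.obj A))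
    (g : W ⟶ K.TN.obj (K.P.obj A)) :
    K.powerSystem.Mem x (g ≫ K.sigma A) ↔
      (mapSub K.TN (K.subRel A)).Factors (liftMap K.TN x g) := by
  rw [← PowerSystem.pullback_mem_factors_iff]
  change ((Subobject.pullback _).obj (K.subRel _)).Factors _ ↔ _
  rw [pullback_sigma, pullback_factors_iff, comp_liftMap, prod.lift_fst, prod.lift_snd]

/-- In `M`, the relation `T(S)` on `T A × T B` is the relation `S` on `A × B`. -/
theorem mapSub_pullback_liftMap_factors_iff {A B : N} (S : Subobject (A ⨯ B)) {W : M}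
    (x : W ⟶ K.incl.obj (K.TN.obj A)) (y : W ⟶ K.incl.obj (K.TN.obj B)) :
    (mapSub K.incl ((Subobject.pullback (liftMap K.TN prod.fst prod.snd)).obj
        (mapSub K.TN S))).Factors (liftMap K.incl x y) ↔
      (mapSub K.incl S).Factors
        (liftMap K.incl (x ≫ K.eps.hom.app _) (y ≫ K.eps.hom.app _)) := by
  have e : (liftMap K.incl x y ≫ K.incl.map (liftMap K.TN prod.fst prod.snd)) ≫ K.eps.hom.app _ =
      liftMap K.incl (x ≫ K.eps.hom.app _) (y ≫ K.eps.hom.app _) := by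
    have hn : ∀ {X Y : N} (f : X ⟶ Y), K.eps.hom.app X ≫ K.incl.map f =
        K.incl.map (K.TN.map f) ≫ K.eps.hom.app Y := fun f => (K.eps.hom.naturality f).symm
    apply hom_ext_map_prod K.incl
    · rw [liftMap_fst, Category.assoc, Category.assoc, hn, ← Category.assoc (K.incl.map _),
        ← K.incl.map_comp, liftMap_fst, liftMap_fst_assoc]
    · rw [liftMap_snd, Category.assoc, Category.assoc, hn, ← Category.assoc (K.incl.map _),
        ← K.incl.map_comp, liftMap_snd, liftMap_snd_assoc]
  rw [mapSub_pullback, pullback_factors_iff, mapSub_comp_factors_iff K.incl K.eps, e]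

/-- The compatibility of `sigma` with membership at stages in `M`, where both `T(⊆ᵀ_A)` and
`⊆ᵀ_A` induce the same relation. -/
theorem incl_mem_sigma_iff {A : N} {W : M} (x : W ⟶ K.incl.obj (K.TN.obj (K.TN.obj A)))
    (g : W ⟶ K.incl.obj (K.TN.obj (K.P.obj A))) :
    (mapSub K.incl (K.subRel (K.TN.obj A))).Factors
        (liftMap K.incl x (g ≫ K.incl.map (K.sigma A))) ↔
      (mapSub K.incl (K.subRel A)).Factors
        (liftMap K.incl (x ≫ K.eps.hom.app _) (g ≫ K.eps.hom.app _)) := by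
  rw [← mapSub_pullback_liftMap_factors_iff, ← pullback_sigma, mapSub_pullback,
    pullback_factors_iff, liftMap_prod_map, K.incl.map_id, Category.comp_id]

instance sigma_mono (A : N) : Mono (K.sigma A) := by
  refine ⟨fun {W} g g' e => K.incl.map_injective ?_⟩
  rw [← cancel_mono (K.eps.hom.app _)]
  have e' : K.incl.map g ≫ K.incl.map (K.sigma A) = K.incl.map g' ≫ K.incl.map (K.sigma A) := by
    rw [← K.incl.map_comp, e, K.incl.map_comp]
  refine K.incl_hom_ext fun V k x => ?_
  have h : ∀ f : W ⟶ K.TN.obj (K.P.obj A),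
      (mapSub K.incl (K.subRel A)).Factors
          (liftMap K.incl x (k ≫ K.incl.map f ≫ K.eps.hom.app _)) ↔
        (mapSub K.incl (K.subRel (K.TN.obj A))).Factors (liftMap K.incl (x ≫ K.eps.inv.app _)
          (k ≫ K.incl.map f ≫ K.incl.map (K.sigma A))) := by
    intro f
    rw [← Category.assoc k (K.incl.map f) (K.incl.map (K.sigma A)), incl_mem_sigma_iff]
    simp
  rw [h, h, e']

theorem sigma_naturality {A B : N} (f : A ⟶ B) :
    K.TN.map (K.P.map f) ≫ K.sigma B = K.sigma A ≫ K.P.map (K.TN.map f) := by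
  refine K.powerSystem.hom_ext fun W g y => ?_
  rw [← Category.assoc, mem_sigma_iff, ← Category.assoc, PowerSystem.mem_map_iff]
  have h : liftMap K.TN y (g ≫ K.TN.map (K.P.map f)) =
      liftMap K.TN y g ≫ K.TN.map (prod.map (𝟙 _) (K.P.map f)) := by
    rw [liftMap_prod_map, K.TN.map_id, Category.comp_id]
  rw [h, ← pullback_factors_iff, ← mapSub_pullback, subRel, K.map_power, mapSub_existsSub_TN,
    existsSub_factors_iff]
  constructor
  · rintro ⟨V, c, z, hc, hz, e⟩
    have e1 := e =≫ K.TN.map prod.fst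
    have e2 := e =≫ K.TN.map prod.snd
    simp only [Category.assoc, ← K.TN.map_comp, prod.map_fst, prod.map_snd, liftMap_fst,
      liftMap_snd, Category.comp_id] at e1 e2
    refine ⟨V, c, z ≫ K.TN.map prod.fst, hc, ?_, by rw [Category.assoc, ← K.TN.map_comp, e1]⟩
    rw [← Category.assoc, mem_sigma_iff, ← e2]
    have e3 : liftMap K.TN (z ≫ K.TN.map prod.fst) (z ≫ K.TN.map prod.snd) = z :=
      hom_ext_map_prod K.TN (liftMap_fst _ _ _) (liftMap_snd _ _ _)
    rw [e3]
    exact hz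
  · rintro ⟨V, c, x, hc, hx, e⟩
    rw [← Category.assoc, mem_sigma_iff] at hx
    refine ⟨V, c, _, hc, hx, ?_⟩
    rw [liftMap_prod_map, comp_liftMap, e, K.TN.map_id, Category.comp_id]

theorem map_sing_comp_sigma (A : N) :
    K.TN.map (K.powerSystem.sing A) ≫ K.sigma A = K.powerSystem.sing (K.TN.obj A) := by
  have h : (Subobject.pullback (prod.map (𝟙 (K.TN.obj A)) (K.powerSystem.sing A))).obj
      (K.subRel A) = equalizerSubobject prod.fst prod.snd := by
    refine ext_factors fun W z => ?_
    have hz : z = prod.lift (z ≫ prod.fst) (z ≫ prod.snd) := by ext <;> simp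
    rw [equalizerSubobject_factors_iff, hz]
    refine (K.powerSystem.pullback_mem_factors_iff _ _ _).trans ?_
    rw [PowerSystem.mem_sing_iff, ← hz]
  refine K.powerSystem.hom_ext fun W g x => ?_
  rw [← Category.assoc, mem_sigma_iff, PowerSystem.mem_sing_iff]
  have e : liftMap K.TN x (g ≫ K.TN.map (K.powerSystem.sing A)) =
      liftMap K.TN x g ≫ K.TN.map (prod.map (𝟙 _) (K.powerSystem.sing A)) := by
    rw [liftMap_prod_map, K.TN.map_id, Category.comp_id]
  rw [e, ← pullback_factors_iff, ← mapSub_pullback, h, mapSub_equalizerSubobject_factors_iff,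
    liftMap_fst, liftMap_snd]

/-! ### The object of truth values -/

theorem exists_truth : ∃ t : ⊤_ N ⟶ K.P.obj (⊤_ N), ∀ ⦃W : N⦄ (g : W ⟶ ⊤_ N)
    (x : W ⟶ K.TN.obj (⊤_ N)), K.powerSystem.Mem x (g ≫ t) := by
  obtain ⟨t, ht⟩ := K.powerSystem.exists_hom (A := ⊤_ N) (B := ⊤_ N) ⊤
  exact ⟨t, fun W g x => (ht g x).2 (top_factors _)⟩

/-- The truth value `⊤`, a point of `P 1`. -/
noncomputable def truth : ⊤_ N ⟶ K.P.obj (⊤_ N) := K.exists_truth.choose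

theorem factors_truth_iff {W : N} (q : W ⟶ K.P.obj (⊤_ N)) (x : W ⟶ K.TN.obj (⊤_ N)) :
    (Subobject.mk K.truth).Factors q ↔ K.powerSystem.Mem x q := by
  rw [mk_factors_iff_exists]
  constructor
  · rintro ⟨k, rfl⟩
    exact K.exists_truth.choose_spec k x
  · intro h
    refine ⟨terminal.from W, ?_⟩
    rw [PowerSystem.eq_sing_of_mem_one _ h]
    exact PowerSystem.eq_sing_of_mem_one _ (K.exists_truth.choose_spec _ x)

theorem exists_pullback_truth_eq {A : N} (D : Subobject A) : ∃ χ : A ⟶ K.P.obj (⊤_ N),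
    (Subobject.pullback χ).obj (Subobject.mk K.truth) = D := by
  obtain ⟨χ, hχ⟩ := K.powerSystem.exists_hom (A := ⊤_ N)
    ((Subobject.pullback (prod.snd : K.TN.obj (⊤_ N) ⨯ A ⟶ A)).obj D)
  refine ⟨χ, ext_factors fun W a => ?_⟩
  rw [pullback_factors_iff,
    K.factors_truth_iff _ ((PowerSystem.isTerminalOne K.TN).from W), hχ, pullback_factors_iff,
    prod.lift_snd]

/-- Membership in a subset of the terminal object is truth. -/
theorem subRel_one :
    K.subRel (⊤_ N) = (Subobject.pullback prod.snd).obj (Subobject.mk K.truth) := by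
  refine ext_factors fun W z => ?_
  rw [pullback_factors_iff, K.factors_truth_iff _ (z ≫ prod.fst), PowerSystem.Mem]
  change (K.subRel _).Factors _ ↔ (K.subRel _).Factors _
  congr!
  ext <;> simp

/-! ### `T P A` and `P T A` are isomorphic compatibly with membership -/

instance : PreservesFiniteLimits (K.TN ⋙ K.TN) := comp_preservesFiniteLimits _ _

/-- The natural endomorphism of `P T` obtained from `μ` and the canonical comparison. -/
noncomputable def alpha : K.TN ⋙ K.P ⟶ K.TN ⋙ K.P where
  app A := K.μ.hom.app A ≫ K.sigma A
  naturality A B f := by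
    have := K.μ.hom.naturality f
    simp only [Functor.comp_map] at this ⊢
    rw [reassoc_of% this, sigma_naturality, Category.assoc]

/-- The preimage of the singletons under `alpha`. -/
noncomputable def delta : K.TN ⋙ K.TN ⟶ K.TN ⋙ K.P where
  app A := K.TN.map (K.powerSystem.sing A) ≫ K.μ.inv.app A
  naturality A B f := by
    have := K.μ.inv.naturality f
    simp only [Functor.comp_map] at this ⊢
    rw [Category.assoc, ← this, ← K.TN.map_comp_assoc, K.powerSystem.sing_naturality,
      K.TN.map_comp_assoc]

instance (A : N) : Mono (K.alpha.app A) := mono_comp (K.μ.hom.app A) (K.sigma A)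

theorem delta_comp_alpha (A : N) :
    K.delta.app A ≫ K.alpha.app A = (K.powerSystem.whisker K.TN).sing A := by
  have h : K.delta.app A ≫ K.alpha.app A = K.powerSystem.sing (K.TN.obj A) := by
    rw [← map_sing_comp_sigma]
    simp [delta, alpha]
  rw [h]
  refine K.powerSystem.hom_ext fun W g x => ?_
  exact (K.powerSystem.mem_sing_iff g x).trans ((K.powerSystem.whisker K.TN).mem_sing_iff g x).symm

/-- Every subterminal object of `N` is fixed by `T`, because this holds in `M`. -/
theorem exists_mk_map_eq (V : Subobject ((K.TN ⋙ K.TN).obj (⊤_ N))) :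
    ∃ (B : N) (i : B ⟶ ⊤_ N) (_ : Mono i), Subobject.mk ((K.TN ⋙ K.TN).map i) = V := by
  have ht := PowerSystem.isTerminalOne (K.TN ⋙ K.TN)
  let V' := (Subobject.pullback (ht.from (⊤_ N))).obj V
  refine ⟨_, V'.arrow, inferInstance, mapSub_injective K.incl (ext_factors fun W y => ?_)⟩
  let e : (K.TN ⋙ K.TN) ⋙ K.incl ≅ K.incl :=
    Functor.associator _ _ _ ≪≫ Functor.isoWhiskerLeft K.TN K.eps ≪≫ K.eps
  change (mapSub K.incl (mapSub (K.TN ⋙ K.TN) V')).Factors y ↔ _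
  rw [mapSub_comp_factors_iff K.incl e, mapSub_pullback, pullback_factors_iff]
  congr!
  exact (IsTerminal.isTerminalObj K.incl _ ht).hom_ext _ _

theorem alpha_one : K.alpha.app (⊤_ N) = 𝟙 _ :=
  PowerSystem.app_one_eq_id (p := K.powerSystem.whisker K.TN) K.delta_comp_alpha K.exists_mk_map_eq

/-- Truth values are fixed by `T`: there is a morphism `P 1 ⟶ T P 1` that preserves and reflects
truth. -/
theorem exists_pullback_map_truth_eq : ∃ τ : K.P.obj (⊤_ N) ⟶ K.TN.obj (K.P.obj (⊤_ N)),
    (Subobject.pullback τ).obj (Subobject.mk (K.TN.map K.truth)) = Subobject.mk K.truth := by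
  have : IsIso (terminal.from (K.TN.obj (⊤_ N))) :=
    ⟨(PowerSystem.isTerminalOne K.TN).from _, (PowerSystem.isTerminalOne K.TN).hom_ext _ _,
      terminalIsTerminal.hom_ext _ _⟩
  refine ⟨inv (K.P.map (terminal.from (K.TN.obj (⊤_ N)))) ≫ K.μ.hom.app (⊤_ N),
    ext_factors fun W q => ?_⟩
  obtain ⟨b, rfl⟩ : ∃ b, b ≫ K.P.map (terminal.from (K.TN.obj (⊤_ N))) = q :=
    ⟨q ≫ inv (K.P.map (terminal.from (K.TN.obj (⊤_ N)))), by simp⟩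
  let x : W ⟶ K.TN.obj (K.TN.obj (⊤_ N)) := (PowerSystem.isTerminalOne (K.TN ⋙ K.TN)).from W
  have h1 : (b ≫ K.μ.hom.app (⊤_ N)) ≫ K.sigma (⊤_ N) = b := by
    have := K.alpha_one
    simp only [alpha] at this
    rw [Category.assoc, this]
    exact Category.comp_id b
  rw [pullback_factors_iff, Category.assoc, IsIso.hom_inv_id_assoc, K.factors_truth_iff _
    (x ≫ K.TN.map (terminal.from _)), PowerSystem.mem_map_iff, ← mapSub_mk]
  have h2 : K.powerSystem.Mem x b ↔
      (mapSub K.TN (Subobject.mk K.truth)).Factors (b ≫ K.μ.hom.app (⊤_ N)) := by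
    rw [← h1, mem_sigma_iff, subRel_one, mapSub_pullback, pullback_factors_iff, liftMap_snd, h1]
  rw [← h2]
  constructor
  · intro h
    exact ⟨W, 𝟙 W, x, IsCover.of_isIso _, by simpa using h, by simp⟩
  · rintro ⟨V, c, y, hc, hy, -⟩
    apply PowerSystem.mem_of_isCover hc
    rwa [(PowerSystem.isTerminalOne (K.TN ⋙ K.TN)).hom_ext (c ≫ x) y]

/-- The comparison is monic by extensionality in `M`, and split epic because `alpha` is. -/
instance isIso_sigma (A : N) : IsIso (K.sigma A) := by
  obtain ⟨τ, hτ⟩ := K.exists_pullback_map_truth_eq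
  have hΩ : ∀ {W : N} (V : Subobject W), ∃ q : W ⟶ (K.TN ⋙ K.TN).obj (K.P.obj (⊤_ N)),
      (Subobject.pullback q).obj (Subobject.mk ((K.TN ⋙ K.TN).map K.truth)) = V := by
    intro W V
    obtain ⟨χ, rfl⟩ := K.exists_pullback_truth_eq V
    refine ⟨χ ≫ τ ≫ K.TN.map τ, ?_⟩
    have h : Subobject.mk ((K.TN ⋙ K.TN).map K.truth) =
        mapSub K.TN (Subobject.mk (K.TN.map K.truth)) := (mapSub_mk K.TN _).symm
    rw [h, Subobject.pullback_comp, Subobject.pullback_comp, ← mapSub_pullback, hτ, mapSub_mk, hτ]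
  have himp : ∀ {A : N} (a b : Subobject A), mapSub (K.TN ⋙ K.TN) (himpSub a b) =
      himpSub (mapSub (K.TN ⋙ K.TN) a) (mapSub (K.TN ⋙ K.TN) b) := by
    have h : ∀ {A : N} (a : Subobject A),
        mapSub (K.TN ⋙ K.TN) a = mapSub K.TN (mapSub K.TN a) :=
      fun a => (mapSub_mk K.TN _).symm
    intro A a b
    rw [h, h, h, mapSub_himpSub_TN, mapSub_himpSub_TN]
  obtain ⟨s, hs⟩ := PowerSystem.exists_comp_app_eq_id (p := K.powerSystem.whisker K.TN)
    K.alpha_one K.delta_comp_alpha K.exists_pullback_truth_eq hΩ himp A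
  have : IsSplitEpi (K.sigma A) := IsSplitEpi.mk' ⟨s ≫ K.μ.hom.app A, by
    rw [Category.assoc]
    exact hs⟩
  exact isIso_of_mono_of_isSplitEpi _

end IMLUCategory

/-! ### Forcing and soundness -/

namespace SetStructure

variable {C : Type u₁} [Category.{v₁} C] [HeytingCategory C] (𝒰 : SetStructure C)

/-- The value of a term under an assignment of generalized elements to the variables. -/
noncomputable def eval {X : C} {n : ℕ} (a : Fin n → (X ⟶ 𝒰.carrier)) : SetTerm n → (X ⟶ 𝒰.carrier)
  | .var i => a i
  | .pair s t => prod.lift (eval a s) (eval a t) ≫ 𝒰.pair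

/-- The generalized element of a context with the given components. -/
noncomputable def tuple {X : C} {n : ℕ} (a : Fin n → (X ⟶ 𝒰.carrier)) : X ⟶ 𝒰.ctx n := Pi.lift a

/-- The projection of a context to one of its variables. -/
noncomputable def proj {n : ℕ} (i : Fin n) : 𝒰.ctx n ⟶ 𝒰.carrier :=
  Pi.π (fun _ : Fin n => 𝒰.carrier) i

/-- The formula holds at the stage `X` under an assignment of generalized elements. -/
def Forces {X : C} {n : ℕ} (a : Fin n → (X ⟶ 𝒰.carrier)) (φ : SetFormula n) : Prop :=
  (𝒰.interp φ).Factors (𝒰.tuple a)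

variable {𝒰}

theorem tuple_proj {X : C} {n : ℕ} (a : Fin n → (X ⟶ 𝒰.carrier)) (i : Fin n) :
    𝒰.tuple a ≫ 𝒰.proj i = a i := limit.lift_π _ _

theorem drop_proj {n : ℕ} (i : Fin n) : 𝒰.drop n ≫ 𝒰.proj i = 𝒰.proj i.succ := limit.lift_π _ _

theorem ctx_hom_ext {X : C} {n : ℕ} {x y : X ⟶ 𝒰.ctx n}
    (h : ∀ i, x ≫ 𝒰.proj i = y ≫ 𝒰.proj i) : x = y := Pi.hom_ext _ _ h

theorem tuple_comp_term {X : C} {n : ℕ} (a : Fin n → (X ⟶ 𝒰.carrier)) (t : SetTerm n) :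
    𝒰.tuple a ≫ 𝒰.term t = 𝒰.eval a t := by
  induction t with
  | var i => exact tuple_proj a i
  | pair s t hs ht => rw [term, eval, ← Category.assoc, prod.comp_lift, hs, ht]

theorem comp_eval {X Y : C} {n : ℕ} (g : Y ⟶ X) (a : Fin n → (X ⟶ 𝒰.carrier)) (t : SetTerm n) :
    g ≫ 𝒰.eval a t = 𝒰.eval (fun i => g ≫ a i) t := by
  induction t with
  | var i => rfl
  | pair s t hs ht => rw [eval, eval, ← Category.assoc, prod.comp_lift, hs, ht]

theorem eval_subst {X : C} {n m : ℕ} (a : Fin m → (X ⟶ 𝒰.carrier)) (σ : Fin n → SetTerm m)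
    (t : SetTerm n) : 𝒰.eval a (t.subst σ) = 𝒰.eval (fun i => 𝒰.eval a (σ i)) t := by
  induction t with
  | var i => rfl
  | pair s t hs ht => rw [SetTerm.subst, eval, eval, hs, ht]

theorem comp_tuple {X Y : C} {n : ℕ} (g : Y ⟶ X) (a : Fin n → (X ⟶ 𝒰.carrier)) :
    g ≫ 𝒰.tuple a = 𝒰.tuple fun i => g ≫ a i :=
  ctx_hom_ext fun i => by rw [Category.assoc, tuple_proj, tuple_proj]

theorem eq_tuple {X : C} {n : ℕ} (x : X ⟶ 𝒰.ctx n) : x = 𝒰.tuple fun i => x ≫ 𝒰.proj i :=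
  ctx_hom_ext fun i => by rw [tuple_proj]

theorem tuple_cons_comp_drop {X : C} {n : ℕ} (u : X ⟶ 𝒰.carrier) (a : Fin n → (X ⟶ 𝒰.carrier)) :
    𝒰.tuple (Fin.cons u a : Fin (n + 1) → (X ⟶ 𝒰.carrier)) ≫ 𝒰.drop n = 𝒰.tuple a :=
  ctx_hom_ext fun i => by rw [Category.assoc, drop_proj, tuple_proj, tuple_proj, Fin.cons_succ]

theorem eq_tuple_cons {X : C} {n : ℕ} (x : X ⟶ 𝒰.ctx (n + 1)) (a : Fin n → (X ⟶ 𝒰.carrier))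
    (h : x ≫ 𝒰.drop n = 𝒰.tuple a) :
    x = 𝒰.tuple (Fin.cons (x ≫ 𝒰.proj 0) a : Fin (n + 1) → (X ⟶ 𝒰.carrier)) := by
  refine ctx_hom_ext fun i => ?_
  rw [tuple_proj]
  refine Fin.cases rfl (fun i => ?_) i
  rw [Fin.cons_succ, ← tuple_proj a i, ← h, Category.assoc, drop_proj]

section

variable {X : C} {n : ℕ} {a : Fin n → (X ⟶ 𝒰.carrier)}

theorem Forces.comp {Y : C} {φ : SetFormula n} (h : 𝒰.Forces a φ) (g : Y ⟶ X) :
    𝒰.Forces (fun i => g ≫ a i) φ := by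
  rw [Forces, ← comp_tuple]
  exact factors_of_factors_right g h

theorem forces_of_isCover {Y : C} {φ : SetFormula n} {c : Y ⟶ X} (hc : IsCover c)
    (h : 𝒰.Forces (fun i => c ≫ a i) φ) : 𝒰.Forces a φ := by
  rw [Forces, ← comp_tuple] at h
  exact hc.factors h

theorem forces_eq_iff {s t : SetTerm n} : 𝒰.Forces a (.eq s t) ↔ 𝒰.eval a s = 𝒰.eval a t := by
  rw [Forces, interp, pullback_factors_iff, prod.comp_lift, tuple_comp_term, tuple_comp_term,
    mk_factors_iff_exists]
  constructor
  · rintro ⟨h, e⟩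
    have e1 : h = 𝒰.eval a s := by simpa [diag] using e =≫ prod.fst
    have e2 : h = 𝒰.eval a t := by simpa [diag] using e =≫ prod.snd
    rw [← e1, ← e2]
  · intro h
    rw [h]
    exact ⟨𝒰.eval a t, by rw [diag, prod.comp_lift, Category.comp_id]⟩

theorem forces_mem_iff {s t : SetTerm n} :
    𝒰.Forces a (.mem s t) ↔ 𝒰.mem.Factors (prod.lift (𝒰.eval a s) (𝒰.eval a t)) := by
  rw [Forces, interp, pullback_factors_iff, prod.comp_lift, tuple_comp_term, tuple_comp_term]

theorem forces_isSet_iff {s : SetTerm n} :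
    𝒰.Forces a (.isSet s) ↔ 𝒰.isSet.Factors (𝒰.eval a s) := by
  rw [Forces, interp, pullback_factors_iff, tuple_comp_term]

theorem forces_and_iff {φ ψ : SetFormula n} :
    𝒰.Forces a (.and φ ψ) ↔ 𝒰.Forces a φ ∧ 𝒰.Forces a ψ := by
  rw [Forces, interp, inf_factors]; rfl

theorem forces_imp_iff {φ ψ : SetFormula n} :
    𝒰.Forces a (.imp φ ψ) ↔ ∀ ⦃Y : C⦄ (g : Y ⟶ X), 𝒰.Forces (fun i => g ≫ a i) φ →
      𝒰.Forces (fun i => g ≫ a i) ψ := by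
  simp only [Forces, interp, himpSub_factors_iff, comp_tuple]

theorem forces_iff_iff {φ ψ : SetFormula n} :
    𝒰.Forces a (.iff φ ψ) ↔ ∀ ⦃Y : C⦄ (g : Y ⟶ X), 𝒰.Forces (fun i => g ≫ a i) φ ↔
      𝒰.Forces (fun i => g ≫ a i) ψ := by
  rw [SetFormula.iff, forces_and_iff, forces_imp_iff, forces_imp_iff]
  exact ⟨fun h Y g => ⟨h.1 g, h.2 g⟩, fun h => ⟨fun Y g => (h g).1, fun Y g => (h g).2⟩⟩

/-- A disjunction holds at a stage that is covered by two subobjects, each of which forces one of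
the disjuncts. -/
theorem forces_or_iff {φ ψ : SetFormula n} :
    𝒰.Forces a (.or φ ψ) ↔ ∃ s t : Subobject X, IsLUB {s, t} ⊤ ∧
      𝒰.Forces (fun i => s.arrow ≫ a i) φ ∧ 𝒰.Forces (fun i => t.arrow ≫ a i) ψ := by
  simp only [Forces, interp, supSub_factors_iff, comp_tuple]

theorem forces_all_iff {φ : SetFormula (n + 1)} :
    𝒰.Forces a (.all φ) ↔ ∀ ⦃Y : C⦄ (g : Y ⟶ X) (u : Y ⟶ 𝒰.carrier),
      𝒰.Forces (Fin.cons u fun i => g ≫ a i : Fin (n + 1) → (Y ⟶ 𝒰.carrier)) φ := by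
  rw [Forces, interp, forallSub_factors_iff]
  constructor
  · intro h Y g u
    exact h g _ (by rw [tuple_cons_comp_drop, comp_tuple])
  · intro h Y g x e
    rw [comp_tuple] at e
    rw [eq_tuple_cons x _ e]
    exact h g _

theorem forces_ex_iff {φ : SetFormula (n + 1)} :
    𝒰.Forces a (.ex φ) ↔ ∃ (Y : C) (c : Y ⟶ X) (u : Y ⟶ 𝒰.carrier), IsCover c ∧
      𝒰.Forces (Fin.cons u fun i => c ≫ a i : Fin (n + 1) → (Y ⟶ 𝒰.carrier)) φ := by
  rw [Forces, interp, existsSub_factors_iff]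
  constructor
  · rintro ⟨Y, c, x, hc, hx, e⟩
    rw [comp_tuple] at e
    rw [eq_tuple_cons x _ e] at hx
    exact ⟨Y, c, _, hc, hx⟩
  · rintro ⟨Y, c, u, hc, hu⟩
    exact ⟨Y, c, _, hc, hu, by rw [tuple_cons_comp_drop, comp_tuple]⟩

end

theorem eval_up {X : C} {n : ℕ} (u : X ⟶ 𝒰.carrier) (a : Fin n → (X ⟶ 𝒰.carrier))
    (t : SetTerm n) : 𝒰.eval (Fin.cons u a : Fin (n + 1) → (X ⟶ 𝒰.carrier)) t.up = 𝒰.eval a t := by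
  rw [SetTerm.up, eval_subst]
  rfl

theorem eval_lift {X : C} {n m : ℕ} (u : X ⟶ 𝒰.carrier) (a : Fin m → (X ⟶ 𝒰.carrier))
    (σ : Fin n → SetTerm m) :
    (fun i => 𝒰.eval (Fin.cons u a : Fin (m + 1) → (X ⟶ 𝒰.carrier)) (SetTerm.lift σ i)) =
      Fin.cons u fun i => 𝒰.eval a (σ i) := by
  funext i
  refine Fin.cases rfl (fun i => ?_) i
  exact eval_up u a (σ i)

theorem forces_subst_iff {n : ℕ} (φ : SetFormula n) {m : ℕ} (σ : Fin n → SetTerm m) {X : C}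
    (a : Fin m → (X ⟶ 𝒰.carrier)) :
    𝒰.Forces a (φ.subst σ) ↔ 𝒰.Forces (fun i => 𝒰.eval a (σ i)) φ := by
  induction φ generalizing m X with
  | bot =>
    exact ⟨fun h => factors_of_botSub_factors h _ _, fun h => factors_of_botSub_factors h _ _⟩
  | eq s t => rw [SetFormula.subst, forces_eq_iff, forces_eq_iff, eval_subst, eval_subst]
  | mem s t => rw [SetFormula.subst, forces_mem_iff, forces_mem_iff, eval_subst, eval_subst]
  | isSet s => rw [SetFormula.subst, forces_isSet_iff, forces_isSet_iff, eval_subst]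
  | and φ ψ hφ hψ => rw [SetFormula.subst, forces_and_iff, forces_and_iff, hφ, hψ]
  | or φ ψ hφ hψ => simp only [SetFormula.subst, forces_or_iff, hφ, hψ, comp_eval]
  | imp φ ψ hφ hψ => simp only [SetFormula.subst, forces_imp_iff, hφ, hψ, comp_eval]
  | all φ hφ => simp only [SetFormula.subst, forces_all_iff, hφ, eval_lift, comp_eval]
  | ex φ hφ => simp only [SetFormula.subst, forces_ex_iff, hφ, eval_lift, comp_eval]

theorem forces_up_iff {X : C} {n : ℕ} (u : X ⟶ 𝒰.carrier) (a : Fin n → (X ⟶ 𝒰.carrier))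
    (φ : SetFormula n) :
    𝒰.Forces (Fin.cons u a : Fin (n + 1) → (X ⟶ 𝒰.carrier)) φ.up ↔ 𝒰.Forces a φ := by
  rw [SetFormula.up, forces_subst_iff]
  rfl

theorem forces_inst_iff {X : C} {n : ℕ} (a : Fin n → (X ⟶ 𝒰.carrier)) (φ : SetFormula (n + 1))
    (t : SetTerm n) : 𝒰.Forces a (φ.inst t) ↔
      𝒰.Forces (Fin.cons (𝒰.eval a t) a : Fin (n + 1) → (X ⟶ 𝒰.carrier)) φ := by
  rw [SetFormula.inst, forces_subst_iff]
  have h : (fun i => 𝒰.eval a ((Fin.cons t SetTerm.var : Fin (n + 1) → SetTerm n) i)) =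
      Fin.cons (𝒰.eval a t) a := funext (Fin.cases rfl fun i => rfl)
  rw [h]

theorem valid_iff_forces {n : ℕ} {φ : SetFormula n} :
    𝒰.Valid φ ↔ ∀ ⦃X : C⦄ (a : Fin n → (X ⟶ 𝒰.carrier)), 𝒰.Forces a φ := by
  constructor
  · intro h X a
    rw [Forces, show 𝒰.interp φ = ⊤ from h]
    exact top_factors _
  · intro h
    rw [Valid, eq_top_iff_factors, eq_tuple (𝟙 _)]
    exact h _

theorem valid_closure {n : ℕ} {φ : SetFormula n}
    (h : ∀ ⦃X : C⦄ (a : Fin n → (X ⟶ 𝒰.carrier)), 𝒰.Forces a φ) : 𝒰.Valid φ.closure := by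
  induction n with
  | zero => exact valid_iff_forces.2 h
  | succ n ih => exact ih fun X a => forces_all_iff.2 fun Y g u => h _

theorem forces_or_not (hC : BooleanCategory C) {X : C} {n : ℕ} (a : Fin n → (X ⟶ 𝒰.carrier))
    (φ : SetFormula n) : 𝒰.Forces a (.or φ φ.not) := by
  obtain ⟨b, hb, hb'⟩ := hC.exists_compl (𝒰.interp φ)
  have hle : b ≤ himpSub (𝒰.interp φ) (botSub _) := by
    rw [le_himpSub_iff, inf_comm]
    exact hb _
  have htop : 𝒰.interp (.or φ φ.not) = ⊤ := by
    refine top_le_iff.1 (hb'.2 ?_)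
    have hsup := (supSub_isLUB (𝒰.interp φ) (himpSub (𝒰.interp φ) (botSub _))).1
    rintro _ (rfl | rfl)
    · exact hsup (Set.mem_insert _ _)
    · exact hle.trans (hsup (Set.mem_insert_of_mem _ rfl))
  exact valid_iff_forces.1 htop a

theorem forces_of_derivable {cl : Bool} {Ax : Set (SetFormula 0)} (hAx : 𝒰.Models Ax)
    (hcl : cl = true → BooleanCategory C) {n : ℕ} {Γ : List (SetFormula n)} {φ : SetFormula n}
    (d : Derivable cl Ax Γ φ) {X : C} (a : Fin n → (X ⟶ 𝒰.carrier))
    (hΓ : ∀ ψ ∈ Γ, 𝒰.Forces a ψ) : 𝒰.Forces a φ := by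
  have hcons : ∀ {n : ℕ} {X : C} {a : Fin n → (X ⟶ 𝒰.carrier)} {Γ : List (SetFormula n)}
      {χ : SetFormula n}, 𝒰.Forces a χ → (∀ ψ ∈ Γ, 𝒰.Forces a ψ) →
      ∀ ψ ∈ χ :: Γ, 𝒰.Forces a ψ := by
    intro n X a Γ χ h hΓ
    simpa using ⟨h, hΓ⟩
  have hup : ∀ {n : ℕ} {X Y : C} {a : Fin n → (X ⟶ 𝒰.carrier)} {Γ : List (SetFormula n)}
      (g : Y ⟶ X) (u : Y ⟶ 𝒰.carrier), (∀ ψ ∈ Γ, 𝒰.Forces a ψ) → ∀ ψ ∈ Γ.map SetFormula.up,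
      𝒰.Forces (Fin.cons u fun i => g ≫ a i : Fin (n + 1) → (Y ⟶ 𝒰.carrier)) ψ := by
    intro n X Y a Γ g u h ψ hψ
    obtain ⟨χ, hχ, rfl⟩ := List.mem_map.1 hψ
    rw [forces_up_iff]
    exact (h χ hχ).comp g
  induction d generalizing X with
  | @ax n Γ φ h =>
    rw [forces_subst_iff]
    exact valid_iff_forces.1 (hAx φ h) _
  | hyp h => exact hΓ _ h
  | botE _ ih => exact factors_of_botSub_factors (ih a hΓ) _ _
  | andI _ _ ih₁ ih₂ => exact forces_and_iff.2 ⟨ih₁ a hΓ, ih₂ a hΓ⟩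
  | andE₁ _ ih => exact (forces_and_iff.1 (ih a hΓ)).1
  | andE₂ _ ih => exact (forces_and_iff.1 (ih a hΓ)).2
  | orI₁ _ ih =>
    exact factors_of_le _ ((supSub_isLUB _ _).1 (Set.mem_insert _ _)) (ih a hΓ)
  | orI₂ _ ih =>
    exact factors_of_le _ ((supSub_isLUB _ _).1 (Set.mem_insert_of_mem _ rfl)) (ih a hΓ)
  | orE _ _ _ ih ih₁ ih₂ =>
    obtain ⟨s, t, hst, hs, ht⟩ := forces_or_iff.1 (ih a hΓ)
    apply factors_of_isLUB_top hst
    · rw [comp_tuple]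
      exact ih₁ _ (hcons hs fun ψ hψ => (hΓ ψ hψ).comp _)
    · rw [comp_tuple]
      exact ih₂ _ (hcons ht fun ψ hψ => (hΓ ψ hψ).comp _)
  | impI _ ih =>
    exact forces_imp_iff.2 fun Y g hg => ih _ (hcons hg fun ψ hψ => (hΓ ψ hψ).comp g)
  | impE _ _ ih₁ ih₂ =>
    have := forces_imp_iff.1 (ih₁ a hΓ) (𝟙 X)
    simp only [Category.id_comp] at this
    exact this (ih₂ a hΓ)
  | allI _ ih => exact forces_all_iff.2 fun Y g u => ih _ (hup g u hΓ)
  | allE t _ ih =>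
    have := forces_all_iff.1 (ih a hΓ) (𝟙 X) (𝒰.eval a t)
    simp only [Category.id_comp] at this
    exact (forces_inst_iff _ _ _).2 this
  | exI t _ ih =>
    refine forces_ex_iff.2 ⟨X, 𝟙 X, 𝒰.eval a t, IsCover.of_isIso _, ?_⟩
    simp only [Category.id_comp]
    exact (forces_inst_iff _ _ _).1 (ih a hΓ)
  | exE _ _ ih₁ ih₂ =>
    obtain ⟨Y, c, u, hc, hu⟩ := forces_ex_iff.1 (ih₁ a hΓ)
    exact forces_of_isCover hc ((forces_up_iff _ _ _).1 (ih₂ _ (hcons hu (hup c u hΓ))))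
  | eqI t => exact forces_eq_iff.2 rfl
  | eqE φ _ _ ih₁ ih₂ =>
    have e := forces_eq_iff.1 (ih₁ a hΓ)
    rw [forces_inst_iff, ← e, ← forces_inst_iff]
    exact ih₂ a hΓ
  | em φ h => exact forces_or_not (hcl h) a φ

theorem interprets_of_models {cl : Bool} {Ax : Set (SetFormula 0)} (hAx : 𝒰.Models Ax)
    (hcl : cl = true → BooleanCategory C) : 𝒰.Interprets cl Ax := fun _ h =>
  valid_iff_forces.2 fun _ a => forces_of_derivable hAx hcl h a (by simp)

end SetStructure

theorem CategoryTheory.Subobject.map_factors_iff {C : Type u₁} [Category.{v₁} C] [HasPullbacks C]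
    {X Y W : C} (f : X ⟶ Y) [Mono f] (S : Subobject X) (y : W ⟶ Y) :
    ((Subobject.map f).obj S).Factors y ↔ ∃ x : W ⟶ X, S.Factors x ∧ x ≫ f = y := by
  have h : (Subobject.map f).obj S = Subobject.mk (S.arrow ≫ f) := by
    conv_lhs => rw [← mk_arrow S]
    rw [Subobject.map_mk]
  rw [h, mk_factors_iff_exists]
  constructor
  · rintro ⟨k, rfl⟩
    exact ⟨k ≫ S.arrow, factors_comp_arrow k, by simp⟩
  · rintro ⟨x, hx, rfl⟩
    obtain ⟨k, rfl⟩ := (factors_iff_exists _ _).1 hx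
    exact ⟨k, by simp⟩

namespace IMLUCategory

variable {M : Type u₁} [Category.{v₁} M] [HeytingCategory M]
  {N : Type u₂} [Category.{v₂} N] [HeytingCategory N] (K : IMLUCategory M N)

/-- The generalized element `a` of `A` is a member of the generalized element `Y` of `P A`, at a
stage in `M`. -/
def InclMem {A : N} {W : M} (a : W ⟶ K.incl.obj A) (Y : W ⟶ K.incl.obj (K.P.obj A)) : Prop :=
  (mapSub K.incl (K.subRel A)).Factors (liftMap K.incl (a ≫ K.eps.inv.app A) Y)

theorem memSub_factors_iff {A : N} {W : M} (a : W ⟶ K.incl.obj A)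
    (Y : W ⟶ K.incl.obj (K.P.obj A)) :
    (K.memSub A).Factors (prod.lift a Y) ↔ K.InclMem a Y := by
  rw [memSub, pullback_factors_iff, prod.lift_map, mk_relMap_factors_iff, iotaN_eq,
    Category.comp_id, InclMem, subRel, imageSubobject_mono]

variable (mS : K.P.obj K.U ⟶ K.U) [Mono mS] (mP : K.U ⨯ K.U ⟶ K.U)

/-- Membership in the model, between generalized elements of `U`: the second one is a set and
contains the first one. -/
def MemU {W : M} (a b : W ⟶ K.incl.obj K.U) : Prop :=
  ∃ Y : W ⟶ K.incl.obj (K.P.obj K.U), Y ≫ K.incl.map mS = b ∧ K.InclMem a Y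

variable {K mS mP}

theorem memU_comp_iff {W : M} {a : W ⟶ K.incl.obj K.U} {Y : W ⟶ K.incl.obj (K.P.obj K.U)} :
    K.MemU mS a (Y ≫ K.incl.map mS) ↔ K.InclMem a Y := by
  constructor
  · rintro ⟨Y', e, h⟩
    rwa [← (cancel_mono _).1 e]
  · exact fun h => ⟨Y, rfl, h⟩

section

variable {X : M} {n : ℕ} {a : Fin n → (X ⟶ (K.setStructure mS mP).carrier)}

theorem forces_mem_iff {s t : SetTerm n} : (K.setStructure mS mP).Forces a (.mem s t) ↔
    K.MemU mS ((K.setStructure mS mP).eval a s) ((K.setStructure mS mP).eval a t) := by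
  refine SetStructure.forces_mem_iff.trans ((map_factors_iff
    (prod.map (𝟙 (K.incl.obj K.U)) (K.incl.map mS)) (K.memSub K.U) _).trans ?_)
  generalize (K.setStructure mS mP).eval a s = x
  generalize (K.setStructure mS mP).eval a t = y
  change X ⟶ K.incl.obj K.U at x y
  change (∃ z, (K.memSub K.U).Factors z ∧
    z ≫ prod.map (𝟙 (K.incl.obj K.U)) (K.incl.map mS) = prod.lift x y) ↔ _
  constructor
  · rintro ⟨z, hz, e⟩
    have e1 : z ≫ prod.fst = x := by simpa using e =≫ prod.fst
    have e2 : (z ≫ prod.snd) ≫ K.incl.map mS = y := by simpa using e =≫ prod.snd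
    refine ⟨z ≫ prod.snd, e2, ?_⟩
    rw [← e1, ← memSub_factors_iff]
    convert hz using 1
    ext <;> simp
  · rintro ⟨Y, rfl, h⟩
    exact ⟨prod.lift x Y, (K.memSub_factors_iff x Y).2 h, by simp⟩

theorem forces_isSet_iff {s : SetTerm n} : (K.setStructure mS mP).Forces a (.isSet s) ↔
    ∃ Y : X ⟶ K.incl.obj (K.P.obj K.U), Y ≫ K.incl.map mS = (K.setStructure mS mP).eval a s :=
  SetStructure.forces_isSet_iff

end

theorem forces_extensionality {X : M} (a : Fin 2 → (X ⟶ (K.setStructure mS mP).carrier)) :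
    (K.setStructure mS mP).Forces a SetFormula.extensionality := by
  refine SetStructure.forces_imp_iff.2 fun Y g h => SetStructure.forces_eq_iff.2 ?_
  obtain ⟨h0, h⟩ := SetStructure.forces_and_iff.1 h
  obtain ⟨h1, h⟩ := SetStructure.forces_and_iff.1 h
  let b (i : Fin 2) : Y ⟶ K.incl.obj K.U := g ≫ a i
  obtain ⟨A, hA : A ≫ K.incl.map mS = b 0⟩ := forces_isSet_iff.1 h0
  obtain ⟨B, hB : B ≫ K.incl.map mS = b 1⟩ := forces_isSet_iff.1 h1
  change b 0 = b 1
  rw [← hA, ← hB]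
  congr 1
  refine K.incl_hom_ext fun V k x => ?_
  have := SetStructure.forces_iff_iff.1
    (SetStructure.forces_all_iff.1 h k (x ≫ K.eps.hom.app K.U)) (𝟙 V)
  rw [forces_mem_iff, forces_mem_iff] at this
  change K.MemU mS (𝟙 V ≫ x ≫ K.eps.hom.app K.U) (𝟙 V ≫ k ≫ b 0) ↔
    K.MemU mS (𝟙 V ≫ x ≫ K.eps.hom.app K.U) (𝟙 V ≫ k ≫ b 1) at this
  rw [← hA, ← hB] at this
  have key : ∀ Z : Y ⟶ K.incl.obj (K.P.obj K.U),
      K.MemU mS (𝟙 V ≫ x ≫ K.eps.hom.app K.U) (𝟙 V ≫ k ≫ Z ≫ K.incl.map mS) ↔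
      (mapSub K.incl (K.subRel K.U)).Factors (liftMap K.incl x (k ≫ Z)) := by
    intro Z
    rw [Category.id_comp, Category.id_comp, ← Category.assoc, memU_comp_iff, InclMem]
    simp
  exact (key A).symm.trans (this.trans (key B))

theorem forces_orderedPair [Mono mP] {X : M} (a : Fin 4 → (X ⟶ (K.setStructure mS mP).carrier)) :
    (K.setStructure mS mP).Forces a SetFormula.orderedPair := by
  refine SetStructure.forces_imp_iff.2 fun Y g h => ?_
  have e := SetStructure.forces_eq_iff.1 h
  let b (i : Fin 4) : Y ⟶ K.incl.obj K.U := g ≫ a i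
  have e' : liftMap K.incl (b 0) (b 1) ≫ K.incl.map mP =
      liftMap K.incl (b 2) (b 3) ≫ K.incl.map mP := by
    rw [liftMap, liftMap, Category.assoc, Category.assoc]
    exact e
  rw [cancel_mono] at e'
  refine SetStructure.forces_and_iff.2 ⟨SetStructure.forces_eq_iff.2 ?_,
    SetStructure.forces_eq_iff.2 ?_⟩
  · change b 0 = b 2
    simpa using e' =≫ K.incl.map prod.fst
  · change b 1 = b 3
    simpa using e' =≫ K.incl.map prod.snd

theorem forces_sethood {X : M} (a : Fin 2 → (X ⟶ (K.setStructure mS mP).carrier)) :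
    (K.setStructure mS mP).Forces a SetFormula.sethood := by
  refine SetStructure.forces_imp_iff.2 fun Y g h => forces_isSet_iff.2 ?_
  obtain ⟨Z, e, -⟩ := forces_mem_iff.1 h
  exact ⟨Z, e⟩

/-! ### Stratified formulas define subobjects in `N` -/

variable (K)

/-- The iterates of `T` on `N`. -/
def powT : ℕ → N ⥤ N
  | 0 => 𝟭 N
  | k + 1 => powT k ⋙ K.TN

instance preservesFiniteLimits_powT : ∀ k : ℕ, PreservesFiniteLimits (K.powT k)
  | 0 => inferInstanceAs (PreservesFiniteLimits (𝟭 N))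
  | k + 1 =>
    haveI := preservesFiniteLimits_powT k
    comp_preservesFiniteLimits (K.powT k) K.TN

/-- The isomorphism `Tᵏ A ≅ A` of `M`, for an object `A` of `N`. -/
noncomputable def down : ∀ (k : ℕ) (A : N), K.incl.obj ((K.powT k).obj A) ⟶ K.incl.obj A
  | 0, A => 𝟙 (K.incl.obj A)
  | k + 1, A => K.eps.hom.app ((K.powT k).obj A) ≫ down k A

instance isIso_down : ∀ (k : ℕ) (A : N), IsIso (K.down k A)
  | 0, A => inferInstanceAs (IsIso (𝟙 (K.incl.obj A)))
  | k + 1, A =>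
    haveI := isIso_down k A
    inferInstanceAs (IsIso (K.eps.hom.app ((K.powT k).obj A) ≫ K.down k A))

theorem down_naturality (k : ℕ) {A B : N} (f : A ⟶ B) :
    K.incl.map ((K.powT k).map f) ≫ K.down k B = K.down k A ≫ K.incl.map f := by
  induction k with
  | zero => exact (Category.comp_id _).trans (Category.id_comp _).symm
  | succ k ih =>
    have h : K.incl.map (K.TN.map ((K.powT k).map f)) ≫ K.eps.hom.app ((K.powT k).obj B) =
      K.eps.hom.app ((K.powT k).obj A) ≫ K.incl.map ((K.powT k).map f) :=
        K.eps.hom.naturality ((K.powT k).map f)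
    change K.incl.map (K.TN.map ((K.powT k).map f)) ≫ K.eps.hom.app _ ≫ K.down k B =
      (K.eps.hom.app _ ≫ K.down k A) ≫ K.incl.map f
    rw [reassoc_of% h, ih, Category.assoc]

variable (mS) in
/-- The membership relation of the model, with the element one level above the set. -/
theorem exists_mem_level (j : ℕ) :
    ∃ S : Subobject (K.TN.obj ((K.powT j).obj K.U) ⨯ (K.powT j).obj K.U), ∀ ⦃W : M⦄
      (x : W ⟶ K.incl.obj (K.TN.obj ((K.powT j).obj K.U)))
      (y : W ⟶ K.incl.obj ((K.powT j).obj K.U)),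
      (mapSub K.incl S).Factors (liftMap K.incl x y) ↔
        K.MemU mS (x ≫ K.eps.hom.app _ ≫ K.down j K.U) (y ≫ K.down j K.U) := by
  induction j with
  | zero =>
    have h : ∃ S : Subobject (K.TN.obj K.U ⨯ K.U), ∀ ⦃W : M⦄
      (x : W ⟶ K.incl.obj (K.TN.obj K.U)) (y : W ⟶ K.incl.obj K.U),
      (mapSub K.incl S).Factors (liftMap K.incl x y) ↔
        K.MemU mS (x ≫ K.eps.hom.app K.U ≫ 𝟙 _) (y ≫ 𝟙 _) := by
      refine ⟨Subobject.mk ((K.subRel K.U).arrow ≫ prod.map (𝟙 (K.TN.obj K.U)) mS),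
        fun W x y => ?_⟩
      rw [mapSub_mk, mk_factors_iff_exists, Category.comp_id, Category.comp_id, K.incl.map_comp]
      constructor
      · rintro ⟨k, e⟩
        have e1 : (k ≫ K.incl.map (K.subRel K.U).arrow) ≫ K.incl.map prod.fst = x := by
          rw [← liftMap_fst K.incl x y, ← e]
          simp only [Category.assoc, ← K.incl.map_comp, prod.map_fst, Category.comp_id]
        have e2 : ((k ≫ K.incl.map (K.subRel K.U).arrow) ≫ K.incl.map prod.snd) ≫
            K.incl.map mS = y := by
          rw [← liftMap_snd K.incl x y, ← e]
          simp only [Category.assoc, ← K.incl.map_comp, prod.map_snd]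
        refine ⟨_, e2, ?_⟩
        rw [InclMem, Category.assoc, Iso.hom_inv_id_app, ← e1]
        refine ⟨k, hom_ext_map_prod K.incl ?_ ?_⟩
        · simp
        · simp
      · rintro ⟨Y, rfl, h⟩
        rw [InclMem, Category.assoc, Iso.hom_inv_id_app] at h
        obtain ⟨k, hk⟩ := (mapSub_factors_iff _ _ _).1 h
        refine ⟨k, ?_⟩
        rw [reassoc_of% hk, liftMap_prod_map]
        simp
    exact h
  | succ j ih =>
    obtain ⟨S, hS⟩ := ih
    refine ⟨(Subobject.pullback (liftMap K.TN prod.fst prod.snd)).obj (mapSub K.TN S),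
      fun W x y => ?_⟩
    refine (K.mapSub_pullback_liftMap_factors_iff S x y).trans ?_
    rw [hS]
    exact iff_of_eq (congrArg₂ (K.MemU mS) (Category.assoc _ _ _) (Category.assoc _ _ _))

/-- A term whose variables range over levels of `U` takes values in a level of `U`, by a morphism
of `N`. -/
theorem exists_eval_eq {n m : ℕ} {s r : Fin n → ℕ} (hr : ∀ i, r i + s i = m) {t : SetTerm n}
    {k : ℕ} (ht : t.HasType s k) {j : ℕ} (hj : j + k = m) {B : N}
    (b : ∀ i, B ⟶ (K.powT (r i)).obj K.U) :
    ∃ τ : B ⟶ (K.powT j).obj K.U, ∀ ⦃W : M⦄ (h : W ⟶ K.incl.obj B),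
      (K.setStructure mS mP).eval (fun i => h ≫ K.incl.map (b i) ≫ K.down (r i) K.U) t =
        h ≫ K.incl.map τ ≫ K.down j K.U := by
  induction t with
  | var i =>
    have hs : s i = k := ht
    obtain rfl : r i = j := by have := hr i; omega
    exact ⟨b i, fun W h => rfl⟩
  | pair t u iht ihu =>
    obtain ⟨τ, hτ⟩ := iht ht.1
    obtain ⟨υ, hυ⟩ := ihu ht.2
    refine ⟨liftMap (K.powT j) τ υ ≫ (K.powT j).map mP, fun W h => ?_⟩
    rw [SetStructure.eval, hτ, hυ]
    have key : liftMap K.incl (h ≫ K.incl.map τ ≫ K.down j K.U) (h ≫ K.incl.map υ ≫ K.down j K.U) =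
        h ≫ K.incl.map (liftMap (K.powT j) τ υ) ≫ K.down j (K.U ⨯ K.U) := by
      apply hom_ext_map_prod K.incl
      · rw [liftMap_fst, Category.assoc, Category.assoc, ← down_naturality,
          ← Category.assoc (K.incl.map _), ← K.incl.map_comp, liftMap_fst]
      · rw [liftMap_snd, Category.assoc, Category.assoc, ← down_naturality,
          ← Category.assoc (K.incl.map _), ← K.incl.map_comp, liftMap_snd]
    rw [K.incl.map_comp, Category.assoc, down_naturality]
    refine (Category.assoc _ _ _).symm.trans ((congrArg (· ≫ K.incl.map mP) key).trans ?_)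
    simp only [Category.assoc]

end IMLUCategory

/-! ### The membership relation of the model -/
namespace IMLUCategory

variable {M : Type u₁} [Category.{v₁} M] [HeytingCategory M]
  {N : Type u₂} [Category.{v₂} N] [HeytingCategory N] (K : IMLUCategory M N)
  {mS : K.P.obj K.U ⟶ K.U} [Mono mS] {mP : K.U ⨯ K.U ⟶ K.U}

/-- A generalized element of `Tᵏ U × B` gives the values of one new variable, of level `k`, and of
the variables given by `B`. -/
theorem comp_map_cons_comp_down {n : ℕ} {r : Fin n → ℕ} (k : ℕ) {B : N}
    (b : ∀ i, B ⟶ (K.powT (r i)).obj K.U) {V W : M} (h : W ⟶ K.incl.obj B) (g : V ⟶ W)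
    (x : V ⟶ K.incl.obj ((K.powT k).obj K.U ⨯ B)) (u : V ⟶ K.incl.obj K.U)
    (hu : x ≫ K.incl.map prod.fst ≫ K.down k K.U = u) (e : x ≫ K.incl.map prod.snd = g ≫ h) :
    (fun i => x ≫ K.incl.map (Fin.cases (motive := fun i => (K.powT k).obj K.U ⨯ B ⟶
        (K.powT ((Fin.cons k r : Fin (n + 1) → ℕ) i)).obj K.U) prod.fst
          (fun i => prod.snd ≫ b i) i) ≫ K.down ((Fin.cons k r : Fin (n + 1) → ℕ) i) K.U) =
      (Fin.cons u (fun i => g ≫ h ≫ K.incl.map (b i) ≫ K.down (r i) K.U) :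
        Fin (n + 1) → (V ⟶ K.incl.obj K.U)) := by
  funext i
  refine Fin.cases ?_ (fun i => ?_) i
  · exact hu
  · change x ≫ K.incl.map (prod.snd ≫ b i) ≫ K.down (r i) K.U =
      g ≫ h ≫ K.incl.map (b i) ≫ K.down (r i) K.U
    rw [K.incl.map_comp, Category.assoc, reassoc_of% e]

/-- Stratified formulas define subobjects in `N`, once every variable of type `k` is moved to the
level `Tᵐ⁻ᵏ U`; `m` has to be large enough to have room for the types of the bound variables. -/
theorem exists_definable {n : ℕ} (φ : SetFormula n) {s : Fin n → ℕ} (hφ : φ.StratifiedBy s) :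
    ∃ m₀ : ℕ, ∀ m ≥ m₀, ∀ r : Fin n → ℕ, (∀ i, r i + s i = m) →
      ∀ (B : N) (b : ∀ i, B ⟶ (K.powT (r i)).obj K.U), ∃ R : Subobject B,
        ∀ ⦃W : M⦄ (h : W ⟶ K.incl.obj B),
          (K.setStructure mS mP).Forces
              (fun i => h ≫ K.incl.map (b i) ≫ K.down (r i) K.U) φ ↔
            (mapSub K.incl R).Factors h := by
  induction φ with
  | bot =>
    refine ⟨0, fun m _ r _ B b => ⟨botSub B, fun W h => ?_⟩⟩
    rw [IsHeytingFunctor.map_bot]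
    exact ⟨fun hf => factors_of_botSub_factors hf _ _, fun hf => factors_of_botSub_factors hf _ _⟩
  | eq t u =>
    obtain ⟨k, ht, hu⟩ := hφ
    refine ⟨k, fun m hm r hr B b => ?_⟩
    obtain ⟨τ, hτ⟩ := K.exists_eval_eq (mS := mS) (mP := mP) hr ht (Nat.sub_add_cancel hm) b
    obtain ⟨υ, hυ⟩ := K.exists_eval_eq (mS := mS) (mP := mP) hr hu (Nat.sub_add_cancel hm) b
    refine ⟨equalizerSubobject τ υ, fun W h => ?_⟩
    rw [SetStructure.forces_eq_iff, hτ, hυ, mapSub_equalizerSubobject_factors_iff]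
    refine Iff.trans ?_ (cancel_mono (K.down (m - k) K.U))
    exact iff_of_eq (congrArg₂ Eq (Category.assoc _ _ _).symm (Category.assoc _ _ _).symm)
  | mem t u =>
    obtain ⟨k, ht, hu⟩ := hφ
    refine ⟨k + 1, fun m hm r hr B b => ?_⟩
    obtain ⟨τ, hτ⟩ := K.exists_eval_eq (mS := mS) (mP := mP) hr ht
      (show (m - (k + 1) + 1) + k = m by omega) b
    obtain ⟨υ, hυ⟩ := K.exists_eval_eq (mS := mS) (mP := mP) hr hu (Nat.sub_add_cancel hm) b
    obtain ⟨S, hS⟩ := K.exists_mem_level mS (m - (k + 1))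
    let τ' : B ⟶ K.TN.obj ((K.powT (m - (k + 1))).obj K.U) := τ
    refine ⟨(Subobject.pullback (prod.lift τ' υ)).obj S, fun W h => ?_⟩
    rw [forces_mem_iff, hτ, hυ, mapSub_pullback, pullback_factors_iff, map_prod_lift, comp_liftMap,
      hS]
    exact iff_of_eq (congrArg₂ (K.MemU mS) (Category.assoc _ _ _).symm
      (Category.assoc _ _ _).symm)
  | isSet t =>
    obtain ⟨k, ht⟩ := hφ
    refine ⟨k, fun m hm r hr B b => ?_⟩
    obtain ⟨τ, hτ⟩ := K.exists_eval_eq (mS := mS) (mP := mP) hr ht (Nat.sub_add_cancel hm) b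
    refine ⟨(Subobject.pullback τ).obj (Subobject.mk ((K.powT (m - k)).map mS)), fun W h => ?_⟩
    rw [forces_isSet_iff, hτ, mapSub_pullback, pullback_factors_iff, mapSub_mk,
      mk_factors_iff_exists]
    constructor
    · rintro ⟨Y, e : Y ≫ K.incl.map mS = h ≫ K.incl.map τ ≫ K.down (m - k) K.U⟩
      refine ⟨Y ≫ inv (K.down (m - k) _), ?_⟩
      rw [← cancel_mono (K.down (m - k) K.U), Category.assoc, Category.assoc, down_naturality,
        IsIso.inv_hom_id_assoc, e, Category.assoc]
    · rintro ⟨y, e⟩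
      refine ⟨y ≫ K.down (m - k) _, ?_⟩
      rw [Category.assoc, ← down_naturality, reassoc_of% e]
  | and φ ψ ihφ ihψ =>
    obtain ⟨m₁, h₁⟩ := ihφ hφ.1
    obtain ⟨m₂, h₂⟩ := ihψ hφ.2
    refine ⟨max m₁ m₂, fun m hm r hr B b => ?_⟩
    obtain ⟨R₁, hR₁⟩ := h₁ m (le_of_max_le_left hm) r hr B b
    obtain ⟨R₂, hR₂⟩ := h₂ m (le_of_max_le_right hm) r hr B b
    refine ⟨R₁ ⊓ R₂, fun W h => ?_⟩
    rw [SetStructure.forces_and_iff, hR₁, hR₂, mapSub_inf, inf_factors]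
  | or φ ψ ihφ ihψ =>
    obtain ⟨m₁, h₁⟩ := ihφ hφ.1
    obtain ⟨m₂, h₂⟩ := ihψ hφ.2
    refine ⟨max m₁ m₂, fun m hm r hr B b => ?_⟩
    obtain ⟨R₁, hR₁⟩ := h₁ m (le_of_max_le_left hm) r hr B b
    obtain ⟨R₂, hR₂⟩ := h₂ m (le_of_max_le_right hm) r hr B b
    refine ⟨supSub R₁ R₂, fun W h => ?_⟩
    rw [SetStructure.forces_or_iff, IsHeytingFunctor.map_sup, supSub_factors_iff]
    simp only [← hR₁, ← hR₂, Category.assoc]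
  | imp φ ψ ihφ ihψ =>
    obtain ⟨m₁, h₁⟩ := ihφ hφ.1
    obtain ⟨m₂, h₂⟩ := ihψ hφ.2
    refine ⟨max m₁ m₂, fun m hm r hr B b => ?_⟩
    obtain ⟨R₁, hR₁⟩ := h₁ m (le_of_max_le_left hm) r hr B b
    obtain ⟨R₂, hR₂⟩ := h₂ m (le_of_max_le_right hm) r hr B b
    refine ⟨himpSub R₁ R₂, fun W h => ?_⟩
    rw [SetStructure.forces_imp_iff, mapSub_himpSub, himpSub_factors_iff]
    simp only [← hR₁, ← hR₂, Category.assoc]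
  | all φ ih =>
    obtain ⟨k, hφ⟩ := hφ
    obtain ⟨m₀, hm₀⟩ := ih hφ
    refine ⟨max m₀ k, fun m hm r hr B b => ?_⟩
    have hk := Nat.sub_add_cancel (le_of_max_le_right hm)
    obtain ⟨R, hR⟩ := hm₀ m (le_of_max_le_left hm) (Fin.cons (m - k) r)
      (Fin.cases hk hr) ((K.powT (m - k)).obj K.U ⨯ B)
      (Fin.cases prod.fst (fun i => prod.snd ≫ b i))
    have key : ∀ {V W : M} (h : W ⟶ K.incl.obj B) (g : V ⟶ W)
        (x : V ⟶ K.incl.obj ((K.powT (m - k)).obj K.U ⨯ B)) (u : V ⟶ K.incl.obj K.U),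
        x ≫ K.incl.map prod.fst ≫ K.down (m - k) K.U = u → x ≫ K.incl.map prod.snd = g ≫ h →
        ((mapSub K.incl R).Factors x ↔ (K.setStructure mS mP).Forces
          (Fin.cons u (fun i => g ≫ h ≫ K.incl.map (b i) ≫ K.down (r i) K.U)) φ) :=
      fun h g x u hu e => (hR x).symm.trans (iff_of_eq (congrArg
        ((K.setStructure mS mP).Forces · φ) (K.comp_map_cons_comp_down (m - k) b h g x u hu e)))
    refine ⟨forallSub prod.snd R, fun W h => ?_⟩
    rw [SetStructure.forces_all_iff, IsHeytingFunctor.map_forall, forallSub_factors_iff]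
    constructor
    · intro hf V g x e
      exact (key h g x _ rfl e).2 (hf g _)
    · intro hf V g u
      change V ⟶ K.incl.obj K.U at u
      exact (key h g (liftMap K.incl (u ≫ inv (K.down (m - k) K.U)) (g ≫ h)) u (by simp)
        (by simp)).1 (hf g _ (by simp))
  | ex φ ih =>
    obtain ⟨k, hφ⟩ := hφ
    obtain ⟨m₀, hm₀⟩ := ih hφ
    refine ⟨max m₀ k, fun m hm r hr B b => ?_⟩
    have hk := Nat.sub_add_cancel (le_of_max_le_right hm)
    obtain ⟨R, hR⟩ := hm₀ m (le_of_max_le_left hm) (Fin.cons (m - k) r)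
      (Fin.cases hk hr) ((K.powT (m - k)).obj K.U ⨯ B)
      (Fin.cases prod.fst (fun i => prod.snd ≫ b i))
    have key : ∀ {V W : M} (h : W ⟶ K.incl.obj B) (g : V ⟶ W)
        (x : V ⟶ K.incl.obj ((K.powT (m - k)).obj K.U ⨯ B)) (u : V ⟶ K.incl.obj K.U),
        x ≫ K.incl.map prod.fst ≫ K.down (m - k) K.U = u → x ≫ K.incl.map prod.snd = g ≫ h →
        ((mapSub K.incl R).Factors x ↔ (K.setStructure mS mP).Forces
          (Fin.cons u (fun i => g ≫ h ≫ K.incl.map (b i) ≫ K.down (r i) K.U)) φ) :=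
      fun h g x u hu e => (hR x).symm.trans (iff_of_eq (congrArg
        ((K.setStructure mS mP).Forces · φ) (K.comp_map_cons_comp_down (m - k) b h g x u hu e)))
    refine ⟨existsSub prod.snd R, fun W h => ?_⟩
    rw [SetStructure.forces_ex_iff, IsHeytingFunctor.map_exists, existsSub_factors_iff]
    constructor
    · rintro ⟨V, c, u, hc, hu⟩
      change V ⟶ K.incl.obj K.U at u
      refine ⟨V, c, liftMap K.incl (u ≫ inv (K.down (m - k) K.U)) (c ≫ h), hc, ?_,
        by simp⟩
      exact (key h c _ u (by simp) (by simp)).2 hu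
    · rintro ⟨V, c, x, hc, hx, e⟩
      exact ⟨V, c, _, hc, (key h c x _ rfl e).1 hx⟩

/-! ### Comprehension -/

/-- In `M` there is a morphism `P Tʲ A ⟶ P A` that is compatible with membership. -/
theorem exists_inclMem_down_iff (j : ℕ) (A : N) :
    ∃ θ : K.incl.obj (K.P.obj ((K.powT j).obj A)) ⟶ K.incl.obj (K.P.obj A), ∀ ⦃W : M⦄
      (a : W ⟶ K.incl.obj ((K.powT j).obj A)) (Y : W ⟶ K.incl.obj (K.P.obj ((K.powT j).obj A))),
      K.InclMem a Y ↔ K.InclMem (a ≫ K.down j A) (Y ≫ θ) := by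
  induction j with
  | zero =>
    exact ⟨𝟙 _, fun W a Y => iff_of_eq (congrArg₂ K.InclMem (Category.comp_id _).symm
      (Category.comp_id _).symm)⟩
  | succ j ih =>
    obtain ⟨θ, hθ⟩ := ih
    -- The step from `T B` to `B` needs a morphism `P T B ⟶ T P B`: the inverse of `sigma`.
    have h : ∀ B : N, ∃ ρ : K.incl.obj (K.P.obj (K.TN.obj B)) ⟶ K.incl.obj (K.P.obj B), ∀ ⦃W : M⦄
        (a : W ⟶ K.incl.obj (K.TN.obj B)) (Y : W ⟶ K.incl.obj (K.P.obj (K.TN.obj B))),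
        K.InclMem a Y ↔ K.InclMem (a ≫ K.eps.hom.app B) (Y ≫ ρ) := by
      refine fun B => ⟨K.incl.map (inv (K.sigma B)) ≫ K.eps.hom.app _, fun W a Y => ?_⟩
      have e : (Y ≫ K.incl.map (inv (K.sigma B))) ≫ K.incl.map (K.sigma B) = Y := by
        rw [Category.assoc, ← K.incl.map_comp, IsIso.inv_hom_id, K.incl.map_id, Category.comp_id]
      conv_lhs => rw [InclMem, ← e, incl_mem_sigma_iff]
      simp [InclMem]
    obtain ⟨ρ, hρ⟩ := h ((K.powT j).obj A)
    exact ⟨ρ ≫ θ, fun W a Y => ((hρ a Y).trans (hθ _ _)).trans (iff_of_eq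
      (congrArg₂ K.InclMem (Category.assoc _ _ _) (Category.assoc _ _ _)))⟩

/-- Every relation of `N` with domain `T` of a level of `A` is the membership relation of a family
of elements of `P A`; the family is a morphism of `M` only. -/
theorem exists_class_level (j : ℕ) {A B : N} (R : Subobject (K.TN.obj ((K.powT j).obj A) ⨯ B)) :
    ∃ y : K.incl.obj B ⟶ K.incl.obj (K.P.obj A), ∀ ⦃W : M⦄
      (x : W ⟶ K.incl.obj (K.TN.obj ((K.powT j).obj A))) (g : W ⟶ K.incl.obj B),
      (mapSub K.incl R).Factors (liftMap K.incl x g) ↔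
        K.InclMem (x ≫ K.eps.hom.app _ ≫ K.down j A) (g ≫ y) := by
  obtain ⟨χ, hχ⟩ := K.powerSystem.exists_class R
  obtain ⟨θ, hθ⟩ := K.exists_inclMem_down_iff j A
  refine ⟨K.incl.map χ ≫ θ, fun W x g => ?_⟩
  rw [← Category.assoc x, ← Category.assoc g, ← hθ, ← hχ, mapSub_pullback, pullback_factors_iff,
    liftMap_prod_map, K.incl.map_id, Category.comp_id, InclMem, Category.assoc,
    Iso.hom_inv_id_app]
  exact iff_of_eq (congrArg (fun z => (mapSub K.incl (K.subRel _)).Factors (liftMap K.incl z _))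
    (Category.comp_id _).symm)

theorem exists_tuple_level {n : ℕ} (r : Fin n → ℕ) {X : M} (a : Fin n → (X ⟶ K.incl.obj K.U)) :
    ∃ h : X ⟶ K.incl.obj (∏ᶜ fun i => (K.powT (r i)).obj K.U), ∀ i,
      h ≫ K.incl.map (Pi.π (fun i => (K.powT (r i)).obj K.U) i) ≫ K.down (r i) K.U = a i := by
  refine ⟨Pi.lift (fun i => a i ≫ inv (K.down (r i) K.U)) ≫
    inv (piComparison K.incl fun i => (K.powT (r i)).obj K.U), fun i => ?_⟩
  rw [← piComparison_comp_π]
  simp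

theorem forces_comprehension {n : ℕ} {φ : SetFormula (n + 1)} (hφ : φ.Stratified) {X : M}
    (a : Fin n → (X ⟶ (K.setStructure mS mP).carrier)) :
    (K.setStructure mS mP).Forces a φ.comprehension := by
  obtain ⟨s, hs⟩ := hφ
  obtain ⟨m₀, hm₀⟩ := K.exists_definable (mS := mS) (mP := mP) φ hs
  -- One more level than the types require, so that the new element lies in some `T (Tʲ U)`.
  let m := max m₀ (Finset.univ.sup s + 1)
  have hm : ∀ i, s i + 1 ≤ m := fun i =>
    le_max_of_le_right (Nat.succ_le_succ (Finset.le_sup (Finset.mem_univ i)))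
  let j := m - (s 0 + 1)
  have hj : j + 1 + s 0 = m := by have := hm 0; omega
  let r (i : Fin n) := m - s i.succ
  have hr (i : Fin n) : r i + s i.succ = m :=
    Nat.sub_add_cancel ((Nat.le_succ _).trans (hm i.succ))
  let b (i : Fin n) := Pi.π (fun i => (K.powT (r i)).obj K.U) i
  obtain ⟨R, hR⟩ := hm₀ m (le_max_left _ _) (Fin.cons (j + 1) r) (Fin.cases hj hr)
    ((K.powT (j + 1)).obj K.U ⨯ ∏ᶜ fun i => (K.powT (r i)).obj K.U)
    (Fin.cases prod.fst fun i => prod.snd ≫ b i)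
  obtain ⟨y, hy⟩ := K.exists_class_level j (A := K.U) R
  obtain ⟨h, hh⟩ := K.exists_tuple_level r a
  refine SetStructure.forces_ex_iff.2 ⟨X, 𝟙 X, h ≫ y ≫ K.incl.map mS, IsCover.of_isIso _,
    SetStructure.forces_and_iff.2 ⟨forces_isSet_iff.2 ⟨h ≫ y, Category.assoc _ _ _⟩,
    SetStructure.forces_all_iff.2 fun Y g z => SetStructure.forces_iff_iff.2 fun V k => ?_⟩⟩
  let u : V ⟶ K.incl.obj K.U := k ≫ z
  let x : V ⟶ K.incl.obj (K.TN.obj ((K.powT j).obj K.U)) :=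
    u ≫ inv (K.eps.hom.app _ ≫ K.down j K.U)
  have hx : x ≫ K.eps.hom.app _ ≫ K.down j K.U = u :=
    (Category.assoc _ _ _).trans ((congrArg (u ≫ ·) (IsIso.inv_hom_id _)).trans
      (Category.comp_id _))
  have hmem : K.MemU mS u (k ≫ g ≫ h ≫ y ≫ K.incl.map mS) ↔
      (mapSub K.incl R).Factors (liftMap K.incl x ((k ≫ g) ≫ h)) := by
    have e : k ≫ g ≫ h ≫ y ≫ K.incl.map mS = (((k ≫ g) ≫ h) ≫ y) ≫ K.incl.map mS := by simp
    rw [e, memU_comp_iff]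
    exact (iff_of_eq (congrArg (K.InclMem · _) hx.symm)).trans (hy _ _).symm
  refine forces_mem_iff.trans (hmem.trans ((hR _).symm.trans ?_))
  rw [SetStructure.forces_subst_iff]
  refine iff_of_eq (congrArg ((K.setStructure mS mP).Forces · φ)
    ((K.comp_map_cons_comp_down (j + 1) b h (k ≫ g) (liftMap K.incl x ((k ≫ g) ≫ h)) u ?_
      (liftMap_snd _ _ _)).trans (funext (Fin.cases rfl fun i => ?_))))
  · exact (liftMap_fst_assoc _ _ _ _).trans hx
  · change (k ≫ g) ≫ h ≫ K.incl.map (b i) ≫ K.down (r i) K.U = k ≫ g ≫ 𝟙 X ≫ a i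
    rw [hh, Category.id_comp]
    exact Category.assoc _ _ _

theorem models_nfuAxioms [Mono mP] : (K.setStructure mS mP).Models nfuAxioms := by
  rintro ψ ((rfl | rfl | rfl) | ⟨n, φ, hφ, rfl⟩)
  · exact SetStructure.valid_closure fun X a => forces_extensionality a
  · exact SetStructure.valid_closure fun X a => forces_orderedPair a
  · exact SetStructure.valid_closure fun X a => forces_sethood a
  · exact SetStructure.valid_closure fun X a => K.forces_comprehension hφ a

theorem models_nfAxioms [Mono mP] [IsIso mS] : (K.setStructure mS mP).Models nfAxioms := by
  rintro ψ (hψ | rfl)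
  · exact K.models_nfuAxioms ψ hψ
  · refine SetStructure.valid_iff_forces.2 fun X a => SetStructure.forces_all_iff.2 fun Y g u =>
      forces_isSet_iff.2 ?_
    have h : ∀ z : Y ⟶ K.incl.obj K.U, ∃ Z, Z ≫ K.incl.map mS = z := fun z =>
      ⟨z ≫ inv (K.incl.map mS), by simp⟩
    exact h u

end IMLUCategory

theorem mainTheorem1 {M : Type u₁} [Category.{v₁} M] [HeytingCategory M]
    {N : Type u₂} [Category.{v₂} N] [HeytingCategory N] (K : IMLUCategory M N) :
    (∃ mS : K.P.obj K.U ⟶ K.U, Mono mS) ∧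
    (∃ mP : K.U ⨯ K.U ⟶ K.U, Mono mP) ∧
    (∀ (mS : K.P.obj K.U ⟶ K.U) [Mono mS] (mP : K.U ⨯ K.U ⟶ K.U) [Mono mP],
      (K.setStructure mS mP).Models nfuAxioms ∧
      (K.setStructure mS mP).Interprets false nfuAxioms ∧
      (BooleanCategory M → BooleanCategory N →
        (K.setStructure mS mP).Interprets true nfuAxioms) ∧
      (IsIso mS →
        (K.setStructure mS mP).Models nfAxioms ∧
        (K.setStructure mS mP).Interprets false nfAxioms ∧
        (BooleanCategory M → BooleanCategory N →
          (K.setStructure mS mP).Interprets true nfAxioms))) ∧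
    (Nonempty (K.U ≅ K.P.obj K.U) → ∃ mS : K.P.obj K.U ⟶ K.U, IsIso mS) := by
  refine ⟨K.universal _, K.universal _, fun mS _ mP _ => ?_, fun ⟨i⟩ => ⟨i.inv, inferInstance⟩⟩
  have hU : (K.setStructure mS mP).Models nfuAxioms := K.models_nfuAxioms
  refine ⟨hU, SetStructure.interprets_of_models hU (by simp),
    fun hM _ => SetStructure.interprets_of_models hU fun _ => hM, fun _ => ?_⟩
  have hF : (K.setStructure mS mP).Models nfAxioms := K.models_nfAxioms
  exact ⟨hF, SetStructure.interprets_of_models hF (by simp),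
    fun hM _ => SetStructure.interprets_of_models hF fun _ => hM⟩
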